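/- Notation. Let $I=\{0,1\}=\mathbb Z/2\mathbb Z$, let $\mathcal D=\bigoplus_{i\ge 0}\mathbb Z/2\mathbb Z$ with standard generators $g_0,g_1,\dots$, and let $\mathcal D_n=\langle g_0,\dots,g_{n-1}\rangle$. The group $\mathcal D$ acts on $I^{\mathcal D}\times I^{\mathbb N}$ by $g\cdot(w,\alpha)=(w(\cdot+g),\alpha+\tau(g))$, where $\tau(g)\in I^{\mathbb N}$ is the sequence of coordinates of $g$ ($\tau(\sum_{i\ge1}\alpha_i g_{i-1})=(\alpha_i)_{i\ge1}$). Let $\zeta=(\zeta_n)_{n\ge 0}$, where $\zeta_n$ is the partition into the orbits of $\mathcal D_n$. For $\sigma=(\sigma_i)_{i\ge0}\in\{0,1\}^{\mathbb N}$ let $\mathcal D^\sigma=\langle g_i:\sigma_i=0\rangle$, let $m^\sigma$ be the push-forward to $I^{\mathcal D}$ of the uniform product measure on $I^{\mathcal D/\mathcal D^\sigma}$ under composition with the quotient map $\mathcal D\to\mathcal D/\mathcal D^\sigma$, and let $\omega^\sigma=m^\sigma\times m$, where $m$ is the uniform product measure on $I^{\mathbb N}$. The graph $\mathrm{OP}$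 of ordered pairs has the vertices $\mathrm{OP}_0=I$ and $\mathrm{OP}_{n+1}=\mathrm{OP}_n\times\mathrm{OP}_n$ on its floors; every $v=(v_0,v_1)\in\mathrm{OP}_{n+1}$ is entered by exactly two edges, one of index $0$ from $v_0$ and one of index $1$ from $v_1$. Let $\mathcal T(\mathrm{OP})$ be the space of infinite paths starting on floor $0$, with the $\sigma$-algebra generated by the cylindrical sets, and let $\xi=(\xi_n)_{n\ge0}$, where $\xi_n$ is the partition into sets of paths that coincide from floor $n$ on. Define $\Phi:\mathrm{OP}_n\to I^{\mathcal D_n}$ by $\Phi[v](0)=v$ on floor $0$ and, for $v=(v_0,v_1)\in\mathrm{OP}_{n+1}$, by $\Phi[v](h)=\Phi[v_0](h)$ if $h\in\mathcal D_n$ and $\Phi[v](h)=\Phi[v_1](g_n+h)$ if $h\in\mathcal D_{n+1}\setminus\mathcal D_n$. For a path $x$ with vertices $v_n$ let $\alpha_{n}$ ($n\ge1$) be the index of its edge entering $v_n$, and let $\Psi[x]=(F[x],(\alpha_n)_{n\ge 1})$ with $F[x](g)=\Phi[v_n]\bigl(g+\sum_{i=0}^{n-1}\alpha_{i+1}g_i\bigr)$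 for $g\in\mathcal D_n$, $n\ge1$; this is a well-defined bijection $\Psi:\mathcal T(\mathrm{OP})\to I^{\mathcal D}\times I^{\mathbb N}$. Let $\mu^\sigma$ be the push-forward of $\omega^\sigma$ under $\Psi^{-1}$. Let $\varsigma=(\varsigma_n)_{n\ge0}$ be a dyadic filtration of a Lebesgue space $(X,\mu)$, that is, a sequence of measurable partitions such that $\varsigma_0$ is the partition into points, each element of $\varsigma_{n+1}$ consists of exactly two elements of $\varsigma_n$, and the conditional measures on the elements of $\varsigma_n$ are uniform. For a semimetric $\rho$ on $X$ and elements $c_1,c_2$ of $\varsigma_n$ put $$\mathcal K_n[\rho](c_1,c_2)=\min_{\varphi}\frac1{2^n}\sum_{x\in c_1}\rho(x,\varphi(x)),$$ where $\varphi$ runs over the bijections $c_1\to c_2$ that preserve the hierarchy formed by the elements of $\varsigma_0,\dots,\varsigma_n$. For a measure space $(Y,\nu)$ with a semimetric $d$, let $\mathbb H_\varepsilon(Y,\nu,d)$ be the binary logarithm of the least positive integer $k$ for which $Y$ splits into measurable sets $Y_0,\dots,Y_k$ with $\nu(Y_0)<\varepsilon$ and with $Y_1,\dots,Y_k$ of $d$-diameter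 less than $\varepsilon$ ($+\infty$ if there is no such $k$). A summable admissible metric on $(X,\mu)$ is a semimetric on $X$ that is measurable and integrable with respect to $\mu\times\mu$ and that, on some set of full measure, is separable and a metric. A sequence $(h_n)_{n\ge1}$ of positive numbers is a scaling sequence of $\varsigma$ if for some, and also for every, summable admissible metric $\rho$ $$0<\liminf_{n\to\infty}\frac{\mathbb H_\varepsilon(X/\varsigma_n,\mu/\varsigma_n,\mathcal K_n[\rho])}{h_n}\le\limsup_{n\to\infty}\frac{\mathbb H_\varepsilon(X/\varsigma_n,\mu/\varsigma_n,\mathcal K_n[\rho])}{h_n}<\infty\quad\text{for all sufficiently small }\varepsilon>0.$$ Theorem. For every $\sigma\in\{0,1\}^{\mathbb N}$ the sequence $h_n=2^{\sum_{i=0}^{n-1}\sigma_i}$, $n\ge1$, is a scaling sequence of the dyadic filtration $\zeta$ on $(I^{\mathcal D}\times I^{\mathbb N},\omega^\sigma)$ and also of the dyadic filtration $\xi$ on $(\mathcal T(\mathrm{OP}),\mu^\sigma)$, which is isomorphic to $\zeta$: the map $\Psi$ is an isomorphism of the measure spaces and takes $\xi_n$ to $\zeta_n$ for every $n\ge0$.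 -/

import Mathlib

open MeasureTheory Filter
open scoped ENNReal

noncomputable section

namespace ScaledEntropy

/-! Semimetrics, admissibility and epsilon-entropy -/

/-- A (finite) semimetric on a set: a pseudometric; distinct points may be at distance zero. -/
structure IsSemimetric {X : Type*} (ρ : X → X → ℝ) : Prop where
  nonneg : ∀ x y, 0 ≤ ρ x y
  self : ∀ x, ρ x x = 0
  symm : ∀ x y, ρ x y = ρ y x
  triangle : ∀ x y z, ρ x z ≤ ρ x y + ρ y z

/-- `S` is separable in the semimetric `ρ`. -/
def SeparableOn {X : Type*} (ρ : X → X → ℝ) (S : Set X) : Prop :=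
  ∃ C : Set X, C.Countable ∧ C ⊆ S ∧ ∀ x ∈ S, ∀ ε : ℝ, 0 < ε → ∃ c ∈ C, ρ x c < ε

/-- A summable admissible metric on `(X, μ)`: a semimetric that is measurable (with respect to the
completion of `μ × μ`) and summable as a function of two variables, and that is separable, and
separates points, on some set of full measure. -/
structure IsSummableAdmissibleMetric {X : Type*} [MeasurableSpace X] (μ : Measure X)
    (ρ : X → X → ℝ) : Prop where
  semimetric : IsSemimetric ρ
  measurable : AEMeasurable (fun p : X × X => ρ p.1 p.2) (μ.prod μ)
  summable : Integrable (fun p : X × X => ρ p.1 p.2) (μ.prod μ)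
  separable : ∃ S : Set X, μ Sᶜ = 0 ∧ SeparableOn ρ S ∧ ∀ x ∈ S, ∀ y ∈ S, ρ x y = 0 → x = y

/-- `X` splits into measurable sets `P 0, P 1, …, P k`, where `P 0` has measure less than `ε` and
each of `P 1, …, P k` has diameter less than `ε` in the semimetric `ρ`. -/
def HasEpsPartition {X : Type*} [MeasurableSpace X] (μ : Measure X) (ρ : X → X → ℝ)
    (ε : ℝ) (k : ℕ) : Prop :=
  ∃ P : Fin (k + 1) → Set X,
    (∀ j, MeasurableSet (P j)) ∧ Pairwise (fun i j => Disjoint (P i) (P j)) ∧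
    (⋃ j, P j) = Set.univ ∧ μ (P 0) < ENNReal.ofReal ε ∧
    ∀ j : Fin k, ∃ δ : ℝ, δ < ε ∧ ∀ x ∈ P j.succ, ∀ y ∈ P j.succ, ρ x y ≤ δ

/-- The `ε`-entropy of `(X, μ, ρ)`: the binary logarithm of the least positive `k` admitting a
partition as above, and `⊤` if there is no such `k`. -/
def epsEntropy {X : Type*} [MeasurableSpace X] (μ : Measure X) (ρ : X → X → ℝ) (ε : ℝ) : ℝ≥0∞ :=
  ⨅ (k : ℕ) (_ : 0 < k ∧ HasEpsPartition μ ρ ε k), ENNReal.ofReal (Real.logb 2 k)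

/-- `a n ≍ h n`: `0 < liminf a n / h n ≤ limsup a n / h n < ∞`. -/
def AsympEquiv (a : ℕ → ℝ≥0∞) (h : ℕ → ℝ) : Prop :=
  0 < liminf (fun n => a n / ENNReal.ofReal (h n)) atTop ∧
    limsup (fun n => a n / ENNReal.ofReal (h n)) atTop < ⊤

/-! Dyadic filtrations and their scaling sequences -/

/-- A sequence of partitions (given as equivalence relations) `ς 0, ς 1, …` of `(X, μ)` is a dyadic
filtration: `ς 0` is the partition into points, every element of `ς (n + 1)` consists of exactly two
elements of `ς n`, the partitions are measurable in the sense of Rokhlin (modulo a null set, the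
elements are separated by countably many measurable unions of elements), and the conditional
measures of `μ` on the elements of `ς n` are uniform on their `2 ^ n` points. -/
structure IsDyadicFiltration {X : Type*} [MeasurableSpace X] (μ : Measure X)
    (ς : ℕ → Setoid X) : Prop where
  points : ς 0 = ⊥
  mono : ∀ n, ς n ≤ ς (n + 1)
  two : ∀ n x, ∃ y, ς (n + 1) x y ∧ ¬ ς n x y ∧ ∀ z, ς (n + 1) x z → ς n x z ∨ ς n y z
  measurable : ∀ n, ∃ (S : Set X) (B : ℕ → Set X), μ Sᶜ = 0 ∧ (∀ i, MeasurableSet (B i)) ∧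
    (∀ i x y, ς n x y → (x ∈ B i ↔ y ∈ B i)) ∧
    ∀ x ∈ S, ∀ y ∈ S, (∀ i, x ∈ B i ↔ y ∈ B i) → ς n x y
  count_measurable : ∀ n (B : Set X), MeasurableSet B →
    AEMeasurable (fun x => (({y | ς n x y ∧ y ∈ B} : Set X).ncard : ℝ≥0∞)) μ
  uniform : ∀ n (A B : Set X), MeasurableSet A → (∀ x y, ς n x y → (x ∈ A ↔ y ∈ A)) →
    MeasurableSet B →
    μ (A ∩ B) = ∫⁻ x in A, (({y | ς n x y ∧ y ∈ B} : Set X).ncard : ℝ≥0∞) / 2 ^ n ∂μ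

/-- The points of an element `c` of the partition `ς n`. -/
abbrev Elem {X : Type*} (ς : ℕ → Setoid X) (n : ℕ) (c : Quotient (ς n)) : Type _ :=
  {x : X // Quotient.mk (ς n) x = c}

/-- The bijections between two elements of `ς n` that preserve the hierarchy formed by the elements
of `ς 0, …, ς n`. Once the points of the two elements are numbered compatibly with the hierarchy,
these bijections correspond to the automorphisms of the binary tree of height `n`. -/
abbrev HierarchyIso {X : Type*} (ς : ℕ → Setoid X) (n : ℕ) (c₁ c₂ : Quotient (ς n)) : Type _ :=
  {φ : Elem ς n c₁ ≃ Elem ς n c₂ //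
    ∀ k ≤ n, ∀ x y : Elem ς n c₁, ς k x.1 y.1 ↔ ς k (φ x).1 (φ y).1}

/-- The iterated Kantorovich semimetric on the set of elements of the partition `ς n`. -/
def kantorovichIter {X : Type*} (ς : ℕ → Setoid X) (ρ : X → X → ℝ) (n : ℕ)
    (c₁ c₂ : Quotient (ς n)) : ℝ :=
  ⨅ φ : HierarchyIso ς n c₁ c₂, (1 / 2 ^ n : ℝ) * ∑ᶠ x : Elem ς n c₁, ρ x.1 (φ.1 x).1

/-- `h` is scaling for the semimetric `ρ` and the filtration `ς`: the `ε`-entropies of the quotient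
spaces with the quotient measures and the iterated semimetrics are equivalent to `h`, for all
sufficiently small `ε`. -/
def IsScalingFor {X : Type*} [MeasurableSpace X] (μ : Measure X) (ς : ℕ → Setoid X)
    (ρ : X → X → ℝ) (h : ℕ → ℝ) : Prop :=
  ∃ ε₀ : ℝ, 0 < ε₀ ∧ ∀ ε : ℝ, 0 < ε → ε < ε₀ →
    AsympEquiv (fun n => epsEntropy (μ.map (Quotient.mk (ς n))) (kantorovichIter ς ρ n) ε) h

/-- `h` is a scaling sequence of the dyadic filtration `ς` of `(X, μ)`: it is scaling for some, and
also for every, summable admissible metric. -/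
structure IsScalingSequence {X : Type*} [MeasurableSpace X] (μ : Measure X) (ς : ℕ → Setoid X)
    (h : ℕ → ℝ) : Prop where
  dyadic : IsDyadicFiltration μ ς
  pos : ∀ n, 1 ≤ n → 0 < h n
  some_metric : ∃ ρ, IsSummableAdmissibleMetric μ ρ ∧ IsScalingFor μ ς ρ h
  every_metric : ∀ ρ, IsSummableAdmissibleMetric μ ρ → IsScalingFor μ ς ρ h

/-- A map realizes an isomorphism of two filtrations of measure spaces. -/
structure IsFiltrationIso {X Y : Type*} [MeasurableSpace X] [MeasurableSpace Y]
    (μ : Measure X) (ς : ℕ → Setoid X) (ν : Measure Y) (η : ℕ → Setoid Y) (e : X ≃ Y) : Prop where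
  forward : MeasurePreserving e μ ν
  backward : MeasurePreserving e.symm ν μ
  rel_iff : ∀ n x y, ς n x y ↔ η n (e x) (e y)

/-! The group `𝒟`, the space `I^𝒟 × I^ℕ`, and its tail filtration -/

/-- The two-element set `I = {0, 1}`, with its addition modulo two. -/
abbrev Bit : Type := ZMod 2

/-- The group `𝒟`, the direct sum of countably many groups of order two. -/
abbrev DGroup : Type := ℕ →₀ ZMod 2

/-- The generators `g i` of `𝒟`. -/
def gen (i : ℕ) : DGroup := Finsupp.single i 1

/-- The subgroup `𝒟 n` generated by `g 0, …, g (n - 1)`. -/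
def DSub (n : ℕ) : AddSubgroup DGroup := AddSubgroup.closure {g | ∃ i < n, g = gen i}

/-- The space `I^𝒟 × I^ℕ`; the coordinate `α_{i+1}` of a sequence is the value at `i`. -/
abbrev ConfigSpace : Type := (DGroup → Bit) × (ℕ → Bit)

/-- The action of `𝒟` on `I^𝒟 × I^ℕ`. -/
def diag (g : DGroup) (p : ConfigSpace) : ConfigSpace :=
  (fun h => p.1 (h + g), fun i => p.2 i + g i)

theorem diag_zero (p : ConfigSpace) : diag 0 p = p := by simp [diag]

theorem diag_diag (g h : DGroup) (p : ConfigSpace) : diag g (diag h p) = diag (g + h) p := by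
  simp only [diag, Finsupp.add_apply]
  ext i
  · simp [add_assoc]
  · simp only [add_assoc, add_comm (h i)]

/-- The tail filtration on `I^𝒟 × I^ℕ`: `zeta n` is the partition into orbits of `𝒟 n`. -/
def zeta (n : ℕ) : Setoid ConfigSpace where
  r p q := ∃ g ∈ DSub n, q = diag g p
  iseqv :=
    { refl := fun p => ⟨0, zero_mem _, (diag_zero p).symm⟩
      symm := by
        rintro p q ⟨g, hg, rfl⟩
        exact ⟨-g, neg_mem hg, by rw [diag_diag, neg_add_cancel, diag_zero]⟩
      trans := by
        rintro p q r ⟨g, hg, rfl⟩ ⟨h, hh, rfl⟩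
        exact ⟨h + g, add_mem hh hg, by rw [diag_diag]⟩ }

/-- The Lebesgue measure on `I^J`: the product of uniform measures on `I`. -/
def lebesgue (J : Type*) : Measure (J → Bit) :=
  Measure.infinitePi fun _ : J => ProbabilityTheory.uniformOn (Set.univ : Set Bit)

/-- The subgroup of `𝒟` generated by the `g i` with `σ i = 0`. -/
def DSigma (σ : ℕ → Fin 2) : AddSubgroup DGroup :=
  AddSubgroup.closure {g | ∃ i, σ i = 0 ∧ g = gen i}

/-- The push-forward to `I^𝒟` of the Lebesgue measure on `I^(𝒟 / 𝒟^σ)`. -/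
def mSigma (σ : ℕ → Fin 2) : Measure (DGroup → Bit) :=
  (lebesgue (DGroup ⧸ DSigma σ)).map fun u g => u (QuotientAddGroup.mk g)

/-- The measure `ω^σ` on `I^𝒟 × I^ℕ`. -/
def omegaSigma (σ : ℕ → Fin 2) : Measure ConfigSpace := (mSigma σ).prod (lebesgue ℕ)

/-! The graph of ordered pairs, its path space, and the tail filtration -/

/-- The vertices of floor `n` of the graph of ordered pairs. -/
def Vertex : ℕ → Type
  | 0 => Bit
  | n + 1 => Vertex n × Vertex n

/-- The value of a vertex of floor `0`. -/
def Vertex.val (v : Vertex 0) : Bit := v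

/-- The first component of a vertex of floor `n + 1`. -/
def Vertex.fst {n : ℕ} (v : Vertex (n + 1)) : Vertex n := Prod.fst v

/-- The second component of a vertex of floor `n + 1`. -/
def Vertex.snd {n : ℕ} (v : Vertex (n + 1)) : Vertex n := Prod.snd v

/-- An edge from floor `n` to floor `n + 1` is given by its end on floor `n + 1` and its index:
the edge with index `0` starts at the first component of its end, the edge with index `1` at the
second one. -/
abbrev Edge (n : ℕ) : Type := Vertex (n + 1) × Bit

/-- The beginning of an edge. -/
def Edge.source {n : ℕ} (e : Edge n) : Vertex n := if e.2 = 0 then e.1.fst else e.1.snd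

/-- The path space of the graph of ordered pairs: infinite paths that start on floor `0`. -/
abbrev PathSpace : Type := {x : (n : ℕ) → Edge n // ∀ n, (x n).1 = Edge.source (x (n + 1))}

/-- The set of vertices of a floor is finite and carries the discrete `σ`-algebra; the path space
then carries the `σ`-algebra generated by the cylindrical sets. -/
instance (n : ℕ) : MeasurableSpace (Vertex n) := ⊤

/-- The tail filtration on the path space: `xi n` is the partition into sets of paths that coincide
from floor `n` on. -/
def xi (n : ℕ) : Setoid PathSpace where
  r x y := ∀ k ≥ n, x.1 k = y.1 k
  iseqv :=
    { refl := fun _ _ _ => rfl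
      symm := fun h k hk => (h k hk).symm
      trans := fun h h' k hk => (h k hk).trans (h' k hk) }

/-! The isomorphism between the path space and `I^𝒟 × I^ℕ` -/

/-- The configuration on `𝒟 n` that labels a vertex of floor `n`. It is written as a function on the
whole of `𝒟`, which does not depend on the coordinates with numbers `≥ n`. -/
def label : (n : ℕ) → Vertex n → DGroup → Bit
  | 0, v, _ => v.val
  | n + 1, v, h => if h n = 0 then label n v.fst h else label n v.snd (gen n + h)

/-- The element `∑ i < n, α_{i+1} g_i` of `𝒟`. -/
def partialSum (α : ℕ → Bit) (n : ℕ) : DGroup := ∑ i ∈ Finset.range n, Finsupp.single i (α i)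

/-- The sequence of the indices of the edges of a path. -/
def indexSeq (x : PathSpace) : ℕ → Bit := fun n => (x.1 n).2

/-- The vertex of floor `n` of a path. -/
def vertexAt (x : PathSpace) (n : ℕ) : Vertex n := Edge.source (x.1 n)

/-- The least `n ≥ 1` with `g ∈ 𝒟 n`. -/
def level (g : DGroup) : ℕ := g.support.sup id + 1

/-- The configuration on `𝒟` defined by a path: its value at `g ∈ 𝒟 n` is the label of the vertex of
floor `n` at `g + ∑ i < n, α_{i+1} g_i`. The choice of `n ≥ 1` does not matter. -/
def configOf (x : PathSpace) : DGroup → Bit := fun g =>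
  label (level g) (vertexAt x (level g)) (g + partialSum (indexSeq x) (level g))

/-- The vertex of floor `n` whose label is the restriction of a configuration to `𝒟 n`. -/
def unlabel : (n : ℕ) → (DGroup → Bit) → Vertex n
  | 0, u => u 0
  | n + 1, u => (unlabel n u, unlabel n fun h => u (h + gen n))

theorem bit_cases (b : Bit) : b = 0 ∨ b = 1 := by
  revert b; decide

theorem d_add_self (g : DGroup) : g + g = 0 := by
  ext i
  exact CharTwo.add_self_eq_zero (g i)

theorem partialSum_apply (α : ℕ → Bit) (n i : ℕ) :
    partialSum α n i = if i < n then α i else 0 := by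
  simp [partialSum, Finsupp.finsetSum_apply, Finsupp.single_apply]

theorem level_spec (g : DGroup) (i : ℕ) (hi : level g ≤ i) : g i = 0 := by
  by_contra h
  have := Finset.le_sup (f := id) (Finsupp.mem_support_iff.mpr h)
  simp only [level, id] at *
  omega

theorem label_unlabel (n : ℕ) : ∀ (u : DGroup → Bit) (h : DGroup), (∀ i, n ≤ i → h i = 0) →
    label n (unlabel n u) h = u h := by
  induction n with
  | zero =>
    intro u h hh
    have : h = 0 := by ext i; simpa using hh i
    subst this; rfl
  | succ n ih =>
    intro u h hh
    by_cases h0 : h n = 0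
    · have hn : ∀ i, n ≤ i → h i = 0 := fun i hi => by
        rcases hi.eq_or_lt with rfl | hi
        · exact h0
        · exact hh i hi
      rw [label, if_pos h0]
      exact ih u h hn
    · have h1 : h n = 1 := (bit_cases _).resolve_left h0
      have hn : ∀ i, n ≤ i → (gen n + h) i = 0 := fun i hi => by
        rcases hi.eq_or_lt with rfl | hi
        · simpa [gen, h1] using CharTwo.add_self_eq_zero (1 : ZMod 2)
        · simp [gen, hh i hi, hi.ne]
      have := ih (fun h => u (h + gen n)) (gen n + h) hn
      simp only [label, h0, if_false]
      refine this.trans ?_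
      rw [add_comm (gen n) h, add_assoc, d_add_self, add_zero]

theorem unlabel_congr (n : ℕ) : ∀ (u u' : DGroup → Bit),
    (∀ h : DGroup, (∀ i, n ≤ i → h i = 0) → u h = u' h) → unlabel n u = unlabel n u' := by
  induction n with
  | zero => intro u u' H; exact H 0 (by simp)
  | succ n ih =>
    intro u u' H
    refine Prod.ext (ih _ _ fun h hh => H h fun i hi => hh i (by omega)) (ih _ _ fun h hh => ?_)
    refine H _ fun i hi => ?_
    simp [gen, hh i (by omega), show n ≠ i by omega]

theorem unlabel_label (n : ℕ) : ∀ v : Vertex n, unlabel n (label n v) = v := by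
  induction n with
  | zero => intro v; rfl
  | succ n ih =>
    intro v
    refine Prod.ext ((unlabel_congr n _ _ fun h hh => ?_).trans (ih v.fst))
      ((unlabel_congr n _ _ fun h hh => ?_).trans (ih v.snd))
    · simp [label, hh n le_rfl]
    · have : (h + gen n) n ≠ 0 := by simp [gen, hh n le_rfl]
      simp only [label, this, if_false]
      rw [add_comm, add_assoc, d_add_self, add_zero]

/-- The labels of consecutive vertices of a path agree after the shifts by the partial sums. -/
theorem label_step (x : PathSpace) (n : ℕ) (g : DGroup) (hg : ∀ i, n ≤ i → g i = 0) :
    label (n + 1) (vertexAt x (n + 1)) (g + partialSum (indexSeq x) (n + 1)) =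
      label n (vertexAt x n) (g + partialSum (indexSeq x) n) := by
  have hv : vertexAt x (n + 1) = (x.1 n).1 := (x.2 n).symm
  have hs : partialSum (indexSeq x) (n + 1) =
      partialSum (indexSeq x) n + Finsupp.single n (indexSeq x n) := by
    simp [partialSum, Finset.sum_range_succ]
  have hn : (g + partialSum (indexSeq x) (n + 1)) n = indexSeq x n := by
    simp [hg n le_rfl, partialSum_apply]
  rw [label, hn, hv]
  rcases bit_cases (indexSeq x n) with h0 | h1
  · have h0' : (x.1 n).2 = 0 := h0
    rw [if_pos h0, hs, h0, Finsupp.single_zero, add_zero, vertexAt, Edge.source, if_pos h0']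
  · have h1' : (x.1 n).2 ≠ 0 := by
      rw [show (x.1 n).2 = 1 from h1]; decide
    rw [if_neg (by rw [h1]; decide), hs, h1, vertexAt, Edge.source, if_neg h1']
    congr 1
    change gen n + (g + (_ + gen n)) = _
    rw [← add_assoc g, add_comm, add_assoc, d_add_self, add_zero]

theorem label_of_le (x : PathSpace) (g : DGroup) (n m : ℕ) (hnm : n ≤ m)
    (hg : ∀ i, n ≤ i → g i = 0) :
    label m (vertexAt x m) (g + partialSum (indexSeq x) m) =
      label n (vertexAt x n) (g + partialSum (indexSeq x) n) := by
  induction m, hnm using Nat.le_induction with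
  | base => rfl
  | succ m hm ih => rw [label_step x m g fun i hi => hg i (hm.trans hi), ih]

/-- The value of the configuration of a path can be computed on any floor. -/
theorem configOf_eq (x : PathSpace) (g : DGroup) (n : ℕ) (hg : ∀ i, n ≤ i → g i = 0) :
    configOf x g = label n (vertexAt x n) (g + partialSum (indexSeq x) n) := by
  rcases le_total n (level g) with h | h
  · exact label_of_le x g n _ h hg
  · exact (label_of_le x g _ n h (level_spec g)).symm

/-- The path with a given configuration and a given sequence of indices. -/
def pathOf (p : ConfigSpace) : PathSpace :=
  ⟨fun n => (unlabel (n + 1) fun h => p.1 (h + partialSum p.2 (n + 1)), p.2 n), by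
    intro n
    have hs : partialSum p.2 (n + 2) = partialSum p.2 (n + 1) +
        Finsupp.single (n + 1) (p.2 (n + 1)) := by
      simp [partialSum, Finset.sum_range_succ]
    rcases bit_cases (p.2 (n + 1)) with h0 | h1
    · rw [h0, Finsupp.single_zero, add_zero] at hs
      simp only [Edge.source, h0, if_true]
      change _ = unlabel (n + 1) fun h => p.1 (h + partialSum p.2 (n + 2))
      rw [hs]
    · rw [h1] at hs
      have h1' : p.2 (n + 1) ≠ 0 := by rw [h1]; decide
      simp only [Edge.source, h1', if_false]
      change _ = unlabel (n + 1) fun h => p.1 (h + gen (n + 1) + partialSum p.2 (n + 2))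
      congr 1
      funext h
      refine congrArg p.1 ?_
      rw [hs]
      change _ = h + gen (n + 1) + (_ + gen (n + 1))
      rw [add_assoc, add_comm (gen (n + 1)), add_assoc, d_add_self, add_zero]⟩

theorem vertexAt_pathOf (p : ConfigSpace) (n : ℕ) (hn : 1 ≤ n) :
    vertexAt (pathOf p) n = unlabel n fun h => p.1 (h + partialSum p.2 n) := by
  obtain ⟨m, rfl⟩ : ∃ m, n = m + 1 := ⟨n - 1, by omega⟩
  exact ((pathOf p).2 m).symm

/-- The isomorphism `Ψ` of the path space onto `I^𝒟 × I^ℕ`: a path is taken to its configuration and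
to its sequence of indices. -/
def Psi : PathSpace ≃ ConfigSpace where
  toFun x := (configOf x, indexSeq x)
  invFun := pathOf
  left_inv x := by
    refine Subtype.ext (funext fun n => Prod.ext ?_ rfl)
    have hv : vertexAt x (n + 1) = (x.1 n).1 := (x.2 n).symm
    rw [← hv, ← unlabel_label (n + 1) (vertexAt x (n + 1))]
    refine unlabel_congr _ _ _ fun h hh => ?_
    change configOf x (h + partialSum (indexSeq x) (n + 1)) = _
    rw [configOf_eq x _ (n + 1), add_assoc, d_add_self, add_zero]
    intro i hi
    simp [hh i hi, partialSum_apply, show ¬ i < n + 1 by omega]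
  right_inv p := by
    refine Prod.ext (funext fun g => ?_) rfl
    change configOf (pathOf p) g = p.1 g
    rw [configOf, vertexAt_pathOf _ _ (by simp [level])]
    change label _ _ (g + partialSum p.2 _) = _
    rw [label_unlabel, add_assoc, d_add_self, add_zero]
    intro i hi
    simp [level_spec g i hi, partialSum_apply, show ¬ i < level g by omega]

/-- The measure `μ^σ` on the path space: the push-forward of `ω^σ` under the inverse of `Ψ`. -/
def muSigma (σ : ℕ → Fin 2) : Measure PathSpace := (omegaSigma σ).map Psi.symm

end ScaledEntropy

end

noncomputable section

namespace ScaledEntropy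

open scoped Uniformity

/-! Approximation of admissible metrics -/

/-! The number `2 ^ ones σ n` counts the independent bits in a block. Almost every configuration is
invariant under `DSigma σ`, so its restriction to `DSub n` is a function on a quotient of `DSub n`
with `2 ^ ones σ n` elements, and the values of this function are independent and uniform. The
theorem says that the entropy of the quotient by `zeta n` is comparable with this number of bits:
the tree automorphisms allowed in the iterated metric cannot merge too many blocks.

Upper bound (`exists_hasEpsPartition`). Each orbit has a representative whose first `n` indices
vanish, and the block of this representative takes at most `2 ^ 2 ^ ones σ n` values. If two orbits
have the same block, translation matches points that agree on all of `DSub n` and in the first `n`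
indices. For such points the metric is small up to a function with small integral
(`exists_majorant`), and Markov's inequality for orbit averages discards the bad orbits.

Lower bound (`exists_le_of_hasEpsPartition`). Up to a constant factor and the indicator of a small
set, any admissible metric dominates `cutMetric N` (`exists_label`, `kantorovichIter_comparison`),
so it is enough that balls of the iterated `cutMetric N` have doubly exponentially small measure.
The iterated distance is at least `kant`, given by a recurrence, and one follows the supremum `M n`
over `α` and `q` of the integrals of `expKant σ N t n α q`. If `σ n = 1`, the two halves of a block
are independent and the moment is squared, with an extra factor 2 for the choice between two
couplings. If `σ n = 0`, convexity shows that it does not grow. The factor 2 is harmless only once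
`2 * M n < 1`. This is why `cutMetric N` sees the first `N` indices: they force the coupling in the
first `N` steps, which then cost no factor, and by floor `N` the moment is small enough. Markov's
inequality turns the moment bound into `exists_measure_ball_le`.

The statement for the path space is transported along `Psi`. -/

/-- A countable measurable labelling of a space with a finite tight measure is uniformly locally
constant off a set of small measure. -/
theorem exists_uniform_label {Y : Type*} [UniformSpace Y] [T2Space Y] [MeasurableSpace Y]
    [BorelSpace Y] (ν : Measure Y) [IsFiniteMeasure ν] [ν.InnerRegularCompactLTTop]
    {l : Y → ℕ} (hl : Measurable l) {η : ℝ≥0∞} (hη : η ≠ 0) :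
    ∃ B, MeasurableSet B ∧ ν B < η ∧ ∃ V ∈ 𝓤 Y, ∀ x ∉ B, ∀ y ∉ B, (x, y) ∈ V → l x = l y := by
  have hη2 : η / 2 ≠ 0 := by simpa using hη
  obtain ⟨m, hm⟩ : ∃ m, ν {y | m ≤ l y} < η / 2 := by
    have h := tendsto_measure_iInter_atTop (μ := ν) (s := fun m : ℕ => {y | m ≤ l y})
      (fun m => (hl measurableSet_Ici).nullMeasurableSet)
      (fun a b hab y (hy : b ≤ l y) => hab.trans hy) ⟨0, measure_ne_top _ _⟩
    have he : (⋂ m : ℕ, {y | m ≤ l y}) = ∅ := by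
      ext y
      simp only [Set.mem_iInter, Set.mem_ofPred_eq, Set.mem_empty_iff_false, iff_false, not_forall]
      exact ⟨l y + 1, by omega⟩
    rw [he, measure_empty] at h
    exact (h.eventually (gt_mem_nhds (pos_iff_ne_zero.mpr hη2))).exists
  obtain ⟨ε, hε, hsum⟩ := ENNReal.exists_pos_sum_of_countable' hη2 ℕ
  have hK : ∀ i, ∃ K ⊆ l ⁻¹' {i}, IsCompact K ∧ ν (l ⁻¹' {i} \ K) < ε i := fun i =>
    (hl (measurableSet_singleton i)).exists_isCompact_sdiff_lt (measure_ne_top _ _) (hε i).ne'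
  choose K hKl hKc hKν using hK
  -- Disjoint compact sets are separated by an entourage. Only labels below `m` are kept, so
  -- finitely many entourages are intersected in the end.
  have hV : ∀ i j, ∃ V ∈ 𝓤 Y, i ≠ j → ∀ x ∈ K i, ∀ y ∈ K j, (x, y) ∉ V := by
    intro i j
    by_cases hij : i = j
    · exact ⟨Set.univ, univ_mem, fun h => absurd hij h⟩
    have hd : Disjoint (K i) (K j) := Set.disjoint_left.mpr fun x hx hx' =>
      hij ((hKl i hx : l x = i).symm.trans (hKl j hx'))
    obtain ⟨V, hV, hVd⟩ := hd.exists_uniform_thickening (hKc i) (hKc j).isClosed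
    refine ⟨V, hV, fun _ x hx y hy hxy => Set.disjoint_left.mp hVd (Set.mem_biUnion hx hxy)
      (Set.mem_biUnion hy (UniformSpace.mem_ball_self y hV))⟩
  choose V hVu hVd using hV
  refine ⟨(⋃ i ∈ Finset.range m, K i)ᶜ, ?_, ?_, ⋂ i ∈ Finset.range m, ⋂ j ∈ Finset.range m, V i j,
    ?_, ?_⟩
  · exact (Finset.measurableSet_biUnion _ fun i _ => (hKc i).measurableSet).compl
  · have hsub : (⋃ i ∈ Finset.range m, K i)ᶜ ⊆ {y | m ≤ l y} ∪ ⋃ i, (l ⁻¹' {i} \ K i) := by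
      intro y hy
      by_cases h : m ≤ l y
      · exact Or.inl h
      · refine Or.inr (Set.mem_iUnion.mpr ⟨l y, rfl, fun hyK => hy ?_⟩)
        exact Set.mem_biUnion (Finset.mem_coe.mpr (Finset.mem_range.mpr (not_le.mp h))) hyK
    calc ν _ ≤ ν {y | m ≤ l y} + ν (⋃ i, (l ⁻¹' {i} \ K i)) :=
          (measure_mono hsub).trans (measure_union_le _ _)
      _ ≤ ν {y | m ≤ l y} + ∑' i, ε i := by
          gcongr
          exact (measure_iUnion_le _).trans (ENNReal.tsum_le_tsum fun i => (hKν i).le)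
      _ < η / 2 + η / 2 := ENNReal.add_lt_add hm hsum
      _ = η := ENNReal.add_halves η
  · refine (biInter_finset_mem _).mpr fun i _ => (biInter_finset_mem _).mpr fun j _ => hVu i j
  · intro x hx y hy hxy
    simp only [Set.mem_compl_iff, not_not, Set.mem_iUnion, Finset.mem_range, exists_prop] at hx hy
    obtain ⟨i, hi, hxi⟩ := hx
    obtain ⟨j, hj, hyj⟩ := hy
    rw [show l x = i from hKl i hxi, show l y = j from hKl j hyj]
    by_contra hij
    simp only [Set.mem_iInter, Finset.mem_range] at hxy
    exact hVd i j hij x hxi y hyj (hxy i hi j hj)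

/-- A measurable labelling is uniformly locally constant, off a set of small measure, with respect
to any sequence of measurable functions that separates points. -/
theorem exists_label_of_injOn {X : Type*} [MeasurableSpace X] [StandardBorelSpace X] {μ : Measure X}
    [IsFiniteMeasure μ] {Z : Set X} (hZ : MeasurableSet Z) (hZ0 : μ Z = 0) {F : X → ℕ → ℝ}
    (hF : Measurable F) (hinj : Set.InjOn F Zᶜ) {l : X → ℕ} (hl : Measurable l) {η : ℝ≥0∞}
    (hη : η ≠ 0) :
    ∃ B, MeasurableSet B ∧ Z ⊆ B ∧ μ B < η ∧
      ∃ V ∈ 𝓤 (ℕ → ℝ), ∀ x ∉ B, ∀ y ∉ B, (F x, F y) ∈ V → l x = l y := by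
  have : StandardBorelSpace (Zᶜ : Set X) := hZ.compl.standardBorel
  -- By the Lusin–Souslin theorem an injective measurable map on a standard Borel space is an
  -- embedding, so the label becomes a measurable function of `F x`.
  have hemb : MeasurableEmbedding (fun x : (Zᶜ : Set X) => F x) :=
    (hF.comp measurable_subtype_coe).measurableEmbedding fun x y h =>
      Subtype.ext (hinj x.2 y.2 h)
  obtain ⟨l', hl', hll⟩ := hemb.exists_measurable_extend (hl.comp measurable_subtype_coe)
    fun _ => inferInstance
  obtain ⟨B, hB, hBν, V, hV, hVB⟩ := exists_uniform_label (μ.map F) hl' hη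
  refine ⟨Z ∪ F ⁻¹' B, hZ.union (hF hB), Set.subset_union_left, ?_, V, hV, ?_⟩
  · rw [Measure.map_apply hF hB] at hBν
    exact (measure_union_le _ _).trans_lt (by rwa [hZ0, zero_add])
  · intro x hx y hy hxy
    have hx' : x ∉ Z ∧ F x ∉ B := by simpa using hx
    have hy' : y ∉ Z ∧ F y ∉ B := by simpa using hy
    have := hVB _ hx'.2 _ hy'.2 hxy
    rwa [show l' (F x) = l x from congrFun hll ⟨x, hx'.1⟩,
      show l' (F y) = l y from congrFun hll ⟨y, hy'.1⟩] at this

/-- Joint almost-everywhere measurability controls only almost every section of `ρ`, and the points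
of the given dense set may be exceptional. Each of them is therefore replaced, for every radius `1 /
(k + 1)`, by a point of the corresponding ball with an integrable section, if there is one. The `f
i` are measurable versions of these sections. -/
theorem IsSummableAdmissibleMetric.exists_dense_seq {X : Type*} [MeasurableSpace X]
    {μ : Measure X} [IsProbabilityMeasure μ] {ρ : X → X → ℝ} (hρ : IsSummableAdmissibleMetric μ ρ) :
    ∃ Z, MeasurableSet Z ∧ μ Z = 0 ∧ ∃ (c : ℕ → X) (f : ℕ → X → ℝ), (∀ i, Measurable (f i)) ∧
      (∀ i, Integrable (f i) μ) ∧ (∀ x ∉ Z, ∀ i, ρ (c i) x = f i x) ∧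
      (∀ x ∉ Z, ∀ δ : ℝ, 0 < δ → ∃ i, f i x < δ) ∧ ∀ x ∉ Z, ∀ y ∉ Z, ρ x y = 0 → x = y := by
  obtain ⟨S, hS0, ⟨C, hC, -, hCd⟩, hSsep⟩ := hρ.separable
  have hρs := hρ.semimetric
  set S' : Set X := {x | x ∈ S ∧ Integrable (fun y => ρ x y) μ} with hS'
  have hS'0 : μ S'ᶜ = 0 := by
    have h1 : ∀ᵐ x ∂μ, x ∈ S := hS0
    filter_upwards [h1, hρ.summable.prod_right_ae] with x hx hx'
    exact ⟨hx, hx'⟩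
  obtain ⟨s₀, hs₀⟩ : S'.Nonempty := by
    by_contra h
    rw [Set.not_nonempty_iff_eq_empty.mp h, Set.compl_empty, measure_univ] at hS'0
    exact one_ne_zero hS'0
  have : Countable C := hC
  have hch : ∀ q : C × ℕ, ∃ d ∈ S', ∀ x ∈ S', ρ x q.1 < 1 / (q.2 + 1 : ℝ) →
      ρ d q.1 < 1 / (q.2 + 1 : ℝ) := by
    intro q
    by_cases h : ∃ x ∈ S', ρ x q.1 < 1 / (q.2 + 1 : ℝ)
    · obtain ⟨x, hx, hxq⟩ := h
      exact ⟨x, hx, fun _ _ _ => hxq⟩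
    · exact ⟨s₀, hs₀, fun x hx hxq => absurd ⟨x, hx, hxq⟩ h⟩
  choose d hdS hd using hch
  obtain ⟨c₁, hc₁, -⟩ := hCd s₀ hs₀.1 1 one_pos
  have : Nonempty C := ⟨⟨c₁, hc₁⟩⟩
  obtain ⟨e, he⟩ := exists_surjective_nat (C × ℕ)
  have hint : ∀ i, Integrable (fun y => ρ (d (e i)) y) μ := fun i => (hdS (e i)).2
  set f : ℕ → X → ℝ := fun i => (hint i).1.mk _ with hf
  have hfe : ∀ i, (fun y => ρ (d (e i)) y) =ᵐ[μ] f i := fun i => (hint i).1.ae_eq_mk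
  set Z₀ : Set X := {x | ¬ (x ∈ S' ∧ ∀ i, ρ (d (e i)) x = f i x)} with hZ₀
  have hZ₀0 : μ Z₀ = 0 := by
    have h1 : ∀ᵐ x ∂μ, x ∈ S' := hS'0
    filter_upwards [h1, ae_all_iff.mpr hfe] with x hx hx'
    exact ⟨hx, hx'⟩
  have hZ : ∀ x ∉ toMeasurable μ Z₀, x ∈ S' ∧ ∀ i, ρ (d (e i)) x = f i x := fun x hx => by
    by_contra h
    exact hx (subset_toMeasurable μ Z₀ h)
  refine ⟨toMeasurable μ Z₀, measurableSet_toMeasurable _ _, by rw [measure_toMeasurable, hZ₀0],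
    fun i => d (e i), f, fun i => (hint i).1.stronglyMeasurable_mk.measurable,
    fun i => (hint i).congr (hfe i), fun x hx => (hZ x hx).2, ?_, ?_⟩
  · intro x hx δ hδ
    obtain ⟨k, hk⟩ := exists_nat_one_div_lt (half_pos hδ)
    obtain ⟨c, hcC, hc⟩ := hCd x (hZ x hx).1.1 (1 / (k + 1 : ℝ)) (by positivity)
    obtain ⟨i, hi⟩ := he (⟨c, hcC⟩, k)
    refine ⟨i, ?_⟩
    rw [← (hZ x hx).2 i, hi]
    have h1 := hd (⟨c, hcC⟩, k) x (hZ x hx).1 hc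
    have h2 := hρs.triangle (d (⟨c, hcC⟩, k)) c x
    rw [hρs.symm c x] at h2
    simp only at h1
    linarith
  · exact fun x hx y hy => hSsep x (hZ x hx).1.1 y (hZ y hy).1.1

/-- Off a set of small measure, points that are close in an admissible metric have equal labels. -/
theorem IsSummableAdmissibleMetric.exists_label {X : Type*} [MeasurableSpace X]
    [StandardBorelSpace X] {μ : Measure X} [IsProbabilityMeasure μ] {ρ : X → X → ℝ}
    (hρ : IsSummableAdmissibleMetric μ ρ) {l : X → ℕ} (hl : Measurable l) {η : ℝ≥0∞}
    (hη : η ≠ 0) :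
    ∃ B, MeasurableSet B ∧ μ B < η ∧
      ∃ δ : ℝ, 0 < δ ∧ ∀ x ∉ B, ∀ y ∉ B, ρ x y < δ → l x = l y := by
  obtain ⟨Z, hZ, hZ0, c, f, hf, -, hcf, hdense, hsep⟩ := hρ.exists_dense_seq
  have hρs := hρ.semimetric
  -- The distances to the dense sequence separate points off `Z` and are 1-Lipschitz there, so
  -- `ρ`-close points have close images in the product uniformity.
  set F : X → ℕ → ℝ := fun x i => f i x with hFdef
  have hF : Measurable F := measurable_pi_lambda _ hf
  have hinj : Set.InjOn F Zᶜ := by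
    intro x hx y hy hxy
    refine hsep x hx y hy (le_antisymm (le_of_forall_pos_le_add fun ε hε => ?_) (hρs.nonneg x y))
    obtain ⟨i, hi⟩ := hdense x hx (ε / 2) (half_pos hε)
    have h1 := hρs.triangle x (c i) y
    have h2 : f i x = f i y := congrFun hxy i
    rw [hρs.symm x (c _), hcf x hx, hcf y hy, ← h2] at h1
    linarith
  obtain ⟨B, hB, hZB, hBμ, V, hV, hVB⟩ := exists_label_of_injOn hZ hZ0 hF hinj hl hη
  refine ⟨B, hB, hBμ, ?_⟩
  by_contra hcon
  push Not at hcon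
  have hcon' : ∀ k : ℕ, ∃ x ∉ B, ∃ y ∉ B, ρ x y < 1 / (k + 1 : ℝ) ∧ l x ≠ l y := fun k =>
    hcon _ (by positivity)
  choose x hx y hy hxy hne using hcon'
  have ht : Tendsto (fun k => (F (x k), F (y k))) atTop (𝓤 (ℕ → ℝ)) := by
    rw [Pi.uniformity, tendsto_iInf]
    intro i
    rw [tendsto_comap_iff]
    refine tendsto_uniformity_iff_dist_tendsto_zero.mpr ?_
    refine squeeze_zero (fun _ => dist_nonneg) (fun k => ?_) tendsto_one_div_add_atTop_nhds_zero_nat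
    have hxZ : x k ∉ Z := fun h => hx k (hZB h)
    have hyZ : y k ∉ Z := fun h => hy k (hZB h)
    change |f i (x k) - f i (y k)| ≤ _
    rw [← hcf _ hxZ, ← hcf _ hyZ, abs_le]
    have h1 := hρs.triangle (c i) (x k) (y k)
    have h2 := hρs.triangle (c i) (y k) (x k)
    rw [hρs.symm (y k)] at h2
    constructor <;> linarith [hxy k]
  obtain ⟨k, hk⟩ := (ht.eventually hV).exists
  exact hne k (hVB _ (hx k) _ (hy k) hk)

/-- An admissible metric is dominated, for points that are close with respect to a given separating
sequence of functions, by a function with small integral. -/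
theorem IsSummableAdmissibleMetric.exists_majorant {X : Type*} [MeasurableSpace X]
    [StandardBorelSpace X] {μ : Measure X} [IsProbabilityMeasure μ] {ρ : X → X → ℝ}
    (hρ : IsSummableAdmissibleMetric μ ρ) {G : X → ℕ → ℝ} (hG : Measurable G)
    (hinj : Function.Injective G) {ε : ℝ} (hε : 0 < ε) :
    ∃ V ∈ 𝓤 (ℕ → ℝ), ∃ g : X → ℝ, Measurable g ∧ (∀ x, 0 ≤ g x) ∧ Integrable g μ ∧
      ∫ x, g x ∂μ < ε ∧ ∃ Z, MeasurableSet Z ∧ μ Z = 0 ∧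
      ∀ x ∉ Z, ∀ y ∉ Z, (G x, G y) ∈ V → ρ x y ≤ ε + g x + g y := by
  classical
  obtain ⟨Z, hZ, hZ0, c, f, hf, hfi, hcf, hdense, -⟩ := hρ.exists_dense_seq
  have hρs := hρ.semimetric
  have hl : ∀ x, ∃ i, x ∈ Z ∨ f i x < ε / 2 := fun x => by
    by_cases hx : x ∈ Z
    · exact ⟨0, Or.inl hx⟩
    · exact (hdense x hx _ (half_pos hε)).imp fun _ => Or.inr
  -- The label names a centre at distance less than `ε / 2`, so points with equal labels are less
  -- than `ε` apart. On `Z` the condition is void, only to make the search total.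
  set l : X → ℕ := fun x => Nat.find (hl x) with hldef
  have hlm : Measurable l := measurable_find hl fun i =>
    hZ.union (measurableSet_lt (hf i) measurable_const)
  have hlx : ∀ x ∉ Z, f (l x) x < ε / 2 := fun x hx => (Nat.find_spec (hl x)).resolve_left hx
  set h : X → ℝ := fun x => |f 0 x| with hh
  have hhm : Measurable h := (hf 0).abs
  have hhi : Integrable h μ := (hfi 0).abs
  obtain ⟨M, hM0, hM⟩ : ∃ M : ℝ, 0 < M ∧ ∫ x in {x | M ≤ h x}, h x ∂μ < ε / 4 := by
    have ht := tendsto_setIntegral_of_antitone (μ := μ) (f := h)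
      (s := fun n : ℕ => {x | (n : ℝ) ≤ h x})
      (fun n => measurableSet_le measurable_const hhm)
      (fun a b hab x (hx : (b : ℝ) ≤ h x) => le_trans (Nat.cast_le.mpr hab) hx)
      ⟨0, hhi.integrableOn⟩
    have he : (⋂ n : ℕ, {x | (n : ℝ) ≤ h x}) = ∅ := by
      ext x
      simp only [Set.mem_iInter, Set.mem_ofPred_eq, Set.mem_empty_iff_false, iff_false, not_forall,
        not_le]
      exact exists_nat_gt (h x)
    rw [he, setIntegral_empty] at ht
    obtain ⟨n, hn, hn'⟩ := ((ht.eventually (gt_mem_nhds (show (0 : ℝ) < ε / 4 by positivity))).and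
      (eventually_ge_atTop 1)).exists
    exact ⟨n, by exact_mod_cast hn', hn⟩
  obtain ⟨η, hη, hη'⟩ : ∃ η : ℝ, 0 < η ∧ 2 * M * η ≤ ε / 4 :=
    ⟨ε / (8 * M), by positivity, by field_simp; norm_num⟩
  obtain ⟨B, hB, hZB, hBμ, V, hV, hVB⟩ := exists_label_of_injOn hZ hZ0 hG hinj.injOn hlm
    (ENNReal.ofReal_pos.mpr hη).ne'
  have hBr : μ.real B ≤ η := ENNReal.toReal_le_of_le_ofReal hη.le hBμ.le
  -- Where labels may differ, the crude bound `h x + h y ≤ 2 * M + (g₁ x + g₁ y) / 2` is used. One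
  -- of the two points then lies in `B`, and `g₂` pays for `2 * M`. The integral of `g₁ + g₂` is
  -- below `2 * (ε / 4) + ε / 4`.
  set g₁ : X → ℝ := {x | M ≤ h x}.indicator (fun x => 2 * h x) with hg₁
  set g₂ : X → ℝ := B.indicator (fun _ => 2 * M) with hg₂
  have hMm : MeasurableSet {x | M ≤ h x} := measurableSet_le measurable_const hhm
  have hi₁ : Integrable g₁ μ := (hhi.const_mul 2).indicator hMm
  have hi₂ : Integrable g₂ μ := (integrable_const _).indicator hB
  have hn₁ : ∀ x, 0 ≤ g₁ x := Set.indicator_nonneg fun x _ => by positivity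
  have hn₂ : ∀ x, 0 ≤ g₂ x := Set.indicator_nonneg fun x _ => by positivity
  refine ⟨V, hV, fun x => g₁ x + g₂ x, ?_, fun x => add_nonneg (hn₁ x) (hn₂ x), hi₁.add hi₂, ?_,
    Z, hZ, hZ0, ?_⟩
  · exact ((hhm.const_mul 2).indicator hMm).add (measurable_const.indicator hB)
  · rw [integral_add hi₁ hi₂, hg₁, hg₂, integral_indicator hMm, integral_indicator hB,
      integral_const_mul, setIntegral_const, smul_eq_mul]
    nlinarith
  · have hmaj : ∀ x, h x ≤ M + g₁ x / 2 := fun x => by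
      by_cases hx : M ≤ h x
      · simp only [hg₁, Set.indicator_of_mem (show x ∈ {x | M ≤ h x} from hx)]
        linarith
      · linarith [hn₁ x]
    have hBx : ∀ x ∈ B, g₂ x = 2 * M := fun x hx => by simp only [hg₂, Set.indicator_of_mem hx]
    intro x hx y hy hxy
    have htri : ρ x y ≤ h x + h y := by
      have := hρs.triangle x (c 0) y
      rw [hρs.symm x (c _), hcf x hx, hcf y hy] at this
      exact this.trans (add_le_add (le_abs_self _) (le_abs_self _))
    by_cases hb : x ∉ B ∧ y ∉ B
    · have hll := hVB x hb.1 y hb.2 hxy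
      have := hρs.triangle x (c (l x)) y
      rw [hρs.symm x (c _), hcf x hx, hcf y hy] at this
      have h1 := hlx x hx
      have h2 := hlx y hy
      rw [← hll] at h2
      linarith [hn₁ x, hn₁ y, hn₂ x, hn₂ y]
    · have : 2 * M ≤ g₂ x + g₂ y := by
        by_cases hxB : x ∈ B
        · linarith [hBx x hxB, hn₂ y]
        · have hyB : y ∈ B := by
            by_contra hyB
            exact hb ⟨hxB, hyB⟩
          linarith [hBx y hyB, hn₂ x]
      linarith [hmaj x, hmaj y, hn₁ x, hn₁ y]

/-- Every probability measure on a standard Borel space has a summable admissible metric. -/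
theorem exists_isSummableAdmissibleMetric {X : Type*} [MeasurableSpace X] [StandardBorelSpace X]
    (μ : Measure X) [IsProbabilityMeasure μ] : ∃ ρ, IsSummableAdmissibleMetric μ ρ := by
  -- The arctangent makes the metric bounded, hence integrable.
  set e : X → ℝ := fun x => Real.arctan (embeddingReal X x) with he
  have hem : Measurable e :=
    Real.measurable_arctan.comp (measurableEmbedding_embeddingReal X).measurable
  have hinj : Function.Injective e :=
    Real.arctan_injective.comp (measurableEmbedding_embeddingReal X).injective
  have hm : Measurable fun p : X × X => |e p.1 - e p.2| :=
    ((hem.comp measurable_fst).sub (hem.comp measurable_snd)).abs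
  have hb : ∀ p : X × X, ‖|e p.1 - e p.2|‖ ≤ Real.pi := fun p => by
    rw [Real.norm_eq_abs, abs_abs, abs_le]
    have h1 := Real.arctan_lt_pi_div_two (embeddingReal X p.1)
    have h2 := Real.arctan_lt_pi_div_two (embeddingReal X p.2)
    have h3 := Real.neg_pi_div_two_lt_arctan (embeddingReal X p.1)
    have h4 := Real.neg_pi_div_two_lt_arctan (embeddingReal X p.2)
    simp only [he]
    constructor <;> linarith
  refine ⟨fun x y => |e x - e y|, ⟨fun _ _ => abs_nonneg _, fun _ => by simp,
    fun _ _ => abs_sub_comm _ _, fun _ _ _ => abs_sub_le _ _ _⟩, hm.aemeasurable,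
    Integrable.of_bound hm.aestronglyMeasurable Real.pi (Eventually.of_forall hb), Set.univ,
    by simp, ?_, fun x _ y _ h => hinj (sub_eq_zero.mp (abs_eq_zero.mp h))⟩
  obtain ⟨s, hs, hsd⟩ := TopologicalSpace.exists_countable_dense (Set.range e)
  choose i hi using fun y : Set.range e => y.2
  refine ⟨i '' s, hs.image i, Set.subset_univ _, fun x _ ε hε => ?_⟩
  obtain ⟨y, hy, hys⟩ := hsd.exists_dist_lt ⟨e x, x, rfl⟩ hε
  refine ⟨i y, Set.mem_image_of_mem i hy, ?_⟩
  change |e x - e (i y)| < ε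
  rw [hi y]
  exact hys

/-! Invariance under isomorphisms of filtrations -/

theorem HasEpsPartition.comap {X Y : Type*} [MeasurableSpace X] [MeasurableSpace Y] {μ : Measure X}
    {ν : Measure Y} {f : X → Y} (hf : MeasurePreserving f μ ν) {ρ : Y → Y → ℝ} {ε : ℝ} {k : ℕ}
    (h : HasEpsPartition ν ρ ε k) : HasEpsPartition μ (fun x y => ρ (f x) (f y)) ε k := by
  obtain ⟨P, hP, hd, hu, h0, hδ⟩ := h
  refine ⟨fun j => f ⁻¹' P j, fun j => hf.measurable (hP j), fun i j hij => (hd hij).preimage f,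
    by rw [← Set.preimage_iUnion, hu, Set.preimage_univ], ?_, fun j => ?_⟩
  · rwa [hf.measure_preimage (hP 0).nullMeasurableSet]
  · exact (hδ j).imp fun δ h => ⟨h.1, fun x hx y hy => h.2 _ hx _ hy⟩

namespace IsFiltrationIso

variable {X Y : Type*} [MeasurableSpace X] [MeasurableSpace Y] {μ : Measure X} {ς : ℕ → Setoid X}
  {ν : Measure Y} {η : ℕ → Setoid Y} {e : X ≃ Y}

theorem symm (h : IsFiltrationIso μ ς ν η e) : IsFiltrationIso ν η μ ς e.symm :=
  ⟨h.backward, h.forward, fun n x y => by simp [h.rel_iff]⟩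

theorem ncard_eq (h : IsFiltrationIso μ ς ν η e) (n : ℕ) (x : X) (B : Set X) :
    ({y | η n (e x) y ∧ y ∈ e.symm ⁻¹' B} : Set Y).ncard = ({y | ς n x y ∧ y ∈ B} : Set X).ncard := by
  rw [← Set.ncard_image_of_injective _ e.injective]
  congr 1
  ext y
  constructor
  · rintro ⟨h1, h2⟩
    exact ⟨e.symm y, ⟨(h.rel_iff n _ _).mpr (by simpa using h1), h2⟩, by simp⟩
  · rintro ⟨z, ⟨h1, h2⟩, rfl⟩
    exact ⟨(h.rel_iff n _ _).mp h1, by simpa using h2⟩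

theorem isDyadicFiltration (h : IsFiltrationIso μ ς ν η e) (hη : IsDyadicFiltration ν η) :
    IsDyadicFiltration μ ς where
  points := by
    ext x y
    change ς 0 x y ↔ x = y
    rw [h.rel_iff, hη.points]
    exact e.injective.eq_iff
  mono n x y hxy := (h.rel_iff (n + 1) x y).mpr (hη.mono n ((h.rel_iff n x y).mp hxy))
  two n x := by
    obtain ⟨y, h1, h2, h3⟩ := hη.two n (e x)
    refine ⟨e.symm y, ?_, ?_, fun z hz => ?_⟩
    · simpa [h.rel_iff] using h1
    · simpa [h.rel_iff] using h2
    · rw [h.rel_iff] at hz ⊢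
      simpa [h.rel_iff] using h3 _ hz
  measurable n := by
    obtain ⟨S, B, hS, hB, hinv, hsep⟩ := hη.measurable n
    refine ⟨e ⁻¹' S, fun i => e ⁻¹' B i, ?_, fun i => h.forward.measurable (hB i),
      fun i x y hxy => hinv i _ _ ((h.rel_iff n x y).mp hxy), fun x hx y hy hxy =>
      (h.rel_iff n x y).mpr (hsep _ hx _ hy hxy)⟩
    rw [← Set.preimage_compl]
    exact h.forward.quasiMeasurePreserving.preimage_null hS
  count_measurable n B hB := by
    refine (AEMeasurable.comp_quasiMeasurePreserving (hη.count_measurable n (e.symm ⁻¹' B)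
      (h.backward.measurable hB)) h.forward.quasiMeasurePreserving).congr
      (Eventually.of_forall fun x => ?_)
    change ((_ : ℕ) : ℝ≥0∞) = _
    rw [h.ncard_eq]
  uniform n A B hA hinv hB := by
    have := hη.uniform n (e.symm ⁻¹' A) (e.symm ⁻¹' B) (h.backward.measurable hA)
      (fun x y hxy => hinv _ _ (by simpa [h.rel_iff] using hxy)) (h.backward.measurable hB)
    have hemb : MeasurableEmbedding e :=
      (MeasurableEquiv.mk e h.forward.measurable h.backward.measurable).measurableEmbedding
    rw [← Set.preimage_inter, h.backward.measure_preimage (hA.inter hB).nullMeasurableSet] at this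
    rw [this, ← h.forward.setLIntegral_comp_preimage_emb hemb]
    simp only [h.ncard_eq, ← Set.preimage_comp, Equiv.symm_comp_self, Set.preimage_id]

/-- The bijection of the quotients induced by an isomorphism of filtrations. -/
def quotientEquiv (h : IsFiltrationIso μ ς ν η e) (n : ℕ) : Quotient (ς n) ≃ Quotient (η n) :=
  Quotient.congr e fun x y => h.rel_iff n x y

theorem measurable_quotientEquiv (h : IsFiltrationIso μ ς ν η e) (n : ℕ) :
    Measurable (h.quotientEquiv n) :=
  measurable_from_quotient.mpr (measurable_quotient_mk''.comp h.forward.measurable)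

theorem measurePreserving_quotientEquiv (h : IsFiltrationIso μ ς ν η e) (n : ℕ) :
    MeasurePreserving (h.quotientEquiv n) (μ.map (Quotient.mk (ς n)))
      (ν.map (Quotient.mk (η n))) := by
  refine ⟨h.measurable_quotientEquiv n, ?_⟩
  have := congrArg (Measure.map (Quotient.mk (η n))) h.forward.map_eq
  rw [Measure.map_map measurable_quotient_mk'' h.forward.measurable] at this
  rw [Measure.map_map (h.measurable_quotientEquiv n) measurable_quotient_mk'', ← this]
  rfl

/-- The bijection of elements of partitions induced by an isomorphism of filtrations. -/
def elemEquiv (h : IsFiltrationIso μ ς ν η e) (n : ℕ) (c : Quotient (ς n)) :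
    Elem ς n c ≃ Elem η n (h.quotientEquiv n c) :=
  e.subtypeEquiv fun x => by
    rw [← (h.quotientEquiv n).apply_eq_iff_eq]
    rfl

/-- Conjugation by `e` is a cost-preserving bijection between the families of hierarchy isomorphisms
over which the two infima are taken. -/
theorem kantorovichIter_eq (h : IsFiltrationIso μ ς ν η e) (ρ : Y → Y → ℝ) (n : ℕ)
    (c₁ c₂ : Quotient (ς n)) :
    kantorovichIter ς (fun x y => ρ (e x) (e y)) n c₁ c₂ =
      kantorovichIter η ρ n (h.quotientEquiv n c₁) (h.quotientEquiv n c₂) := by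
  refine Equiv.iInf_congr ((Equiv.equivCongr (h.elemEquiv n c₁) (h.elemEquiv n c₂)).subtypeEquiv
    fun φ => ?_) fun φ => ?_
  · refine forall₂_congr fun k hk => (h.elemEquiv n c₁).forall_congr fun x =>
      (h.elemEquiv n c₁).forall_congr fun y => ?_
    simp only [Equiv.equivCongr_apply_apply, Equiv.symm_apply_apply]
    change _ ↔ (η k (e x.1) (e y.1) ↔ η k (e (φ x).1) (e (φ y).1))
    rw [← h.rel_iff, ← h.rel_iff]
  · congr 1
    refine (finsum_comp_equiv (h.elemEquiv n c₁)).symm.trans (finsum_congr fun x => ?_)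
    simp only [Equiv.subtypeEquiv_apply, Equiv.equivCongr_apply_apply, Equiv.symm_apply_apply]
    rfl

theorem epsEntropy_eq (h : IsFiltrationIso μ ς ν η e) (ρ : Y → Y → ℝ) (n : ℕ) (ε : ℝ) :
    epsEntropy (μ.map (Quotient.mk (ς n))) (kantorovichIter ς (fun x y => ρ (e x) (e y)) n) ε =
      epsEntropy (ν.map (Quotient.mk (η n))) (kantorovichIter η ρ n) ε := by
  refine iInf_congr fun k => iInf_congr_Prop (and_congr_right fun _ => ⟨fun hk => ?_, fun hk => ?_⟩)
    fun _ => rfl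
  · have := hk.comap (h.symm.measurePreserving_quotientEquiv n)
    convert this using 3 with c₁ c₂
    rw [h.kantorovichIter_eq]
    congr 1
    · exact ((h.quotientEquiv n).apply_symm_apply c₁).symm
    · exact ((h.quotientEquiv n).apply_symm_apply c₂).symm
  · have := hk.comap (h.measurePreserving_quotientEquiv n)
    convert this using 3 with c₁ c₂
    exact h.kantorovichIter_eq ρ n c₁ c₂

theorem isScalingFor (h : IsFiltrationIso μ ς ν η e) {ρ : Y → Y → ℝ} {a : ℕ → ℝ}
    (hρ : IsScalingFor ν η ρ a) : IsScalingFor μ ς (fun x y => ρ (e x) (e y)) a := by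
  obtain ⟨ε₀, h0, hε⟩ := hρ
  exact ⟨ε₀, h0, fun ε h1 h2 => by simpa only [h.epsEntropy_eq] using hε ε h1 h2⟩

theorem isSummableAdmissibleMetric [SFinite μ] [SFinite ν] (h : IsFiltrationIso μ ς ν η e)
    {ρ : Y → Y → ℝ} (hρ : IsSummableAdmissibleMetric ν ρ) :
    IsSummableAdmissibleMetric μ (fun x y => ρ (e x) (e y)) where
  semimetric := ⟨fun _ _ => hρ.semimetric.nonneg _ _, fun _ => hρ.semimetric.self _,
    fun _ _ => hρ.semimetric.symm _ _, fun _ _ _ => hρ.semimetric.triangle _ _ _⟩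
  measurable := AEMeasurable.comp_quasiMeasurePreserving hρ.measurable
    (h.forward.prod h.forward).quasiMeasurePreserving
  summable := (h.forward.prod h.forward).integrable_comp_of_integrable hρ.summable
  separable := by
    obtain ⟨S, hS, ⟨C, hC, hCS, hd⟩, hsep⟩ := hρ.separable
    refine ⟨e ⁻¹' S, ?_, ⟨e.symm '' C, hC.image _, ?_, ?_⟩, ?_⟩
    · rw [← Set.preimage_compl]
      exact h.forward.quasiMeasurePreserving.preimage_null hS
    · rintro _ ⟨c, hc, rfl⟩
      simpa using hCS hc
    · intro x hx ε hε
      obtain ⟨c, hc, hxc⟩ := hd _ hx ε hε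
      exact ⟨e.symm c, Set.mem_image_of_mem _ hc, by simpa using hxc⟩
    · exact fun x hx y hy hxy => e.injective (hsep _ hx _ hy hxy)

theorem isScalingSequence [SFinite μ] [SFinite ν] (h : IsFiltrationIso μ ς ν η e) {a : ℕ → ℝ}
    (ha : IsScalingSequence ν η a) : IsScalingSequence μ ς a where
  dyadic := h.isDyadicFiltration ha.dyadic
  pos := ha.pos
  some_metric := by
    obtain ⟨ρ, hρ, hs⟩ := ha.some_metric
    exact ⟨_, h.isSummableAdmissibleMetric hρ, h.isScalingFor hs⟩
  every_metric ρ hρ := by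
    -- The metric is carried to `Y` along the inverse; pulling it back along `e` returns it.
    have := h.isScalingFor (ha.every_metric _ (h.symm.isSummableAdmissibleMetric hρ))
    simpa using this

end IsFiltrationIso

/-! The subgroups `DSub n` -/

theorem gen_apply (i j : ℕ) : gen i j = if i = j then 1 else 0 := by
  simp [gen, Finsupp.single_apply]

theorem d_add_cancel (g h : DGroup) : g + (g + h) = h := by
  rw [← add_assoc, d_add_self, zero_add]

theorem bit_add_self (b : Bit) : b + b = 0 := CharTwo.add_self_eq_zero b

/-- A subgroup generated by some of the generators is given by the vanishing of coordinates. -/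
theorem mem_closure_gen {P : ℕ → Prop} {g : DGroup} :
    g ∈ AddSubgroup.closure {g | ∃ i, P i ∧ g = gen i} ↔ ∀ i, ¬ P i → g i = 0 := by
  constructor
  · intro hg i hi
    refine AddSubgroup.closure_induction (p := fun g _ => g i = 0) ?_ (by simp) ?_ ?_ hg
    · rintro _ ⟨j, hj, rfl⟩
      rw [gen_apply, if_neg]
      rintro rfl
      exact hi hj
    · intro x y _ _ hx hy
      simp [hx, hy]
    · intro x _ hx
      simp [hx]
  · intro h
    rw [← Finsupp.sum_single g, Finsupp.sum]
    refine sum_mem fun i hi => AddSubgroup.subset_closure ⟨i, ?_, ?_⟩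
    · by_contra hP
      exact Finsupp.mem_support_iff.mp hi (h i hP)
    · rw [(bit_cases (g i)).resolve_left (Finsupp.mem_support_iff.mp hi)]
      rfl

theorem mem_DSub {n : ℕ} {g : DGroup} : g ∈ DSub n ↔ ∀ i, n ≤ i → g i = 0 :=
  (mem_closure_gen (P := (· < n)) (g := g)).trans (by simp)

theorem mem_DSigma {σ : ℕ → Fin 2} {g : DGroup} : g ∈ DSigma σ ↔ ∀ i, σ i = 1 → g i = 0 := by
  refine (mem_closure_gen (P := fun i => σ i = 0)).trans (forall_congr' fun i => ?_)
  rw [show ¬ σ i = 0 ↔ σ i = 1 by omega]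

theorem gen_mem_DSub_succ (n : ℕ) : gen n ∈ DSub (n + 1) :=
  AddSubgroup.subset_closure ⟨n, by omega, rfl⟩

theorem DSub_mono {m n : ℕ} (h : m ≤ n) : DSub m ≤ DSub n := fun _ hg =>
  mem_DSub.mpr fun i hi => mem_DSub.mp hg i (h.trans hi)

theorem partialSum_mem_DSub (α : ℕ → Bit) (n : ℕ) : partialSum α n ∈ DSub n :=
  mem_DSub.mpr fun i hi => by rw [partialSum_apply, if_neg (not_lt.mpr hi)]

theorem mem_DSub_succ {n : ℕ} {g : DGroup} :
    g ∈ DSub (n + 1) ↔ g ∈ DSub n ∨ gen n + g ∈ DSub n := by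
  constructor
  · intro hg
    rcases bit_cases (g n) with h | h
    · refine Or.inl (mem_DSub.mpr fun i hi => ?_)
      rcases hi.eq_or_lt with rfl | hi
      · exact h
      · exact mem_DSub.mp hg i hi
    · refine Or.inr (mem_DSub.mpr fun i hi => ?_)
      rcases hi.eq_or_lt with rfl | hi
      · simpa [gen_apply, h] using bit_add_self 1
      · simp [gen_apply, hi.ne, mem_DSub.mp hg i hi]
  · rintro (h | h)
    · exact DSub_mono n.le_succ h
    · simpa [d_add_cancel] using add_mem (gen_mem_DSub_succ n) (DSub_mono n.le_succ h)

/-- The elements of `DSub n`. -/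
def dFin : ℕ → Finset DGroup
  | 0 => {0}
  | n + 1 => dFin n ∪ (dFin n).image (gen n + ·)

theorem mem_dFin {n : ℕ} : ∀ {g : DGroup}, g ∈ dFin n ↔ g ∈ DSub n := by
  induction n with
  | zero =>
    intro g
    rw [dFin, Finset.mem_singleton, mem_DSub]
    exact ⟨fun h => by simp [h], fun h => Finsupp.ext fun i => h i (Nat.zero_le i)⟩
  | succ n ih =>
    intro g
    rw [dFin, Finset.mem_union, Finset.mem_image, mem_DSub_succ, ih]
    refine or_congr_right ⟨?_, fun h => ⟨_, ih.mpr h, d_add_cancel _ _⟩⟩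
    rintro ⟨h, hh, rfl⟩
    rw [d_add_cancel]
    exact ih.mp hh

/-- Coordinate `n` tells `DSub n` from its coset by `gen n`. Inductions over the floors split orbits
in this way. -/
theorem sum_dFin_succ {M : Type*} [AddCommMonoid M] (n : ℕ) (f : DGroup → M) :
    ∑ g ∈ dFin (n + 1), f g = ∑ g ∈ dFin n, f g + ∑ g ∈ dFin n, f (gen n + g) := by
  rw [dFin, Finset.sum_union, Finset.sum_image fun _ _ _ _ h => add_left_cancel h]
  rw [Finset.disjoint_left]
  intro g hg hg'
  obtain ⟨h, hh, rfl⟩ := Finset.mem_image.mp hg'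
  have h1 := mem_DSub.mp (mem_dFin.mp hg) n le_rfl
  have h2 := mem_DSub.mp (mem_dFin.mp hh) n le_rfl
  simp [gen_apply, h2] at h1

theorem card_dFin (n : ℕ) : (dFin n).card = 2 ^ n := by
  induction n with
  | zero => rfl
  | succ n ih =>
    have := sum_dFin_succ n fun _ => 1
    simp only [Finset.sum_const, smul_eq_mul, mul_one] at this
    rw [this, ih, pow_succ]
    ring

/-- A function of finitely many coordinates is measurable. -/
theorem measurable_of_agree {J β : Type*} [MeasurableSpace β] (s : Finset J) {f : (J → Bit) → β}
    (hf : ∀ u v, (∀ i ∈ s, u i = v i) → f u = f v) : Measurable f := by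
  classical
  have : f = (fun v : s → Bit => f fun i => if h : i ∈ s then v ⟨i, h⟩ else 0) ∘ s.restrict := by
    funext u
    exact hf _ _ fun i hi => by simp [hi]
  rw [this]
  exact (measurable_of_finite _).comp (Finset.measurable_restrict s)

/-- The countable group `𝒟` carries the discrete `σ`-algebra. -/
instance : MeasurableSpace DGroup := ⊤

instance : DiscreteMeasurableSpace DGroup := ⟨fun _ => trivial⟩

theorem measurable_partialSum (n : ℕ) : Measurable fun α => partialSum α n :=
  measurable_of_agree (Finset.range n) fun u v h =>
    Finset.sum_congr rfl fun i hi => by rw [h i hi]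

theorem measurable_eval : Measurable fun q : (DGroup → Bit) × DGroup => q.1 q.2 :=
  measurable_from_prod_countable_left fun g => measurable_pi_apply g

theorem measurable_diag' {X : Type*} [MeasurableSpace X] {k : X → DGroup} {f : X → ConfigSpace}
    (hk : Measurable k) (hf : Measurable f) : Measurable fun x => diag (k x) (f x) := by
  refine Measurable.prodMk (measurable_pi_lambda _ fun h => ?_) (measurable_pi_lambda _ fun i => ?_)
  · exact measurable_eval.comp ((measurable_fst.comp hf).prodMk
      ((measurable_of_countable fun g => h + g).comp hk))
  · exact ((measurable_pi_apply i).comp (measurable_snd.comp hf)).add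
      ((measurable_of_countable fun g : DGroup => g i).comp hk)

theorem measurable_diag (g : DGroup) : Measurable (diag g) :=
  measurable_diag' measurable_const measurable_id

/-! The map `Psi` is an isomorphism -/

instance (n : ℕ) : DiscreteMeasurableSpace (Vertex n) := ⟨fun _ => trivial⟩

instance instFiniteVertex : ∀ n, Finite (Vertex n)
  | 0 => inferInstanceAs (Finite Bit)
  | n + 1 =>
    have := instFiniteVertex n
    inferInstanceAs (Finite (Vertex n × Vertex n))

theorem measurable_indexSeq : Measurable indexSeq :=
  measurable_pi_lambda _ fun n =>
    measurable_snd.comp ((measurable_pi_apply n).comp measurable_subtype_coe)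

theorem measurable_vertexAt (n : ℕ) : Measurable fun x => vertexAt x n :=
  (measurable_of_finite (Edge.source : Edge n → Vertex n)).comp
    ((measurable_pi_apply n).comp measurable_subtype_coe)

theorem measurable_label (m : ℕ) (g : DGroup) :
    Measurable fun x => label m (vertexAt x m) (g + partialSum (indexSeq x) m) := by
  have h : Measurable fun q : Vertex m × DGroup => label m q.1 (g + q.2) :=
    measurable_of_countable _
  exact h.comp ((measurable_vertexAt m).prodMk
    ((measurable_partialSum m).comp measurable_indexSeq))

theorem measurable_Psi : Measurable Psi :=
  Measurable.prodMk (measurable_pi_lambda _ fun g => measurable_label (level g) g)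
    measurable_indexSeq

theorem measurable_unlabel (n : ℕ) : Measurable (unlabel n) :=
  measurable_of_agree (dFin n) fun u v h =>
    unlabel_congr n u v fun g hg => h g (mem_dFin.mpr (mem_DSub.mpr hg))

/-- The point of the orbit of `p` under `DSub n` whose first `n` indices are zero. -/
def normalize (n : ℕ) (p : ConfigSpace) : ConfigSpace := diag (partialSum p.2 n) p

theorem measurable_normalize (n : ℕ) : Measurable (normalize n) :=
  measurable_diag' ((measurable_partialSum n).comp measurable_snd) measurable_id

theorem measurable_Psi_symm : Measurable Psi.symm := by
  refine Measurable.subtype_mk (measurable_pi_lambda _ fun n => Measurable.prodMk ?_ ?_)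
  · exact (measurable_unlabel (n + 1)).comp (measurable_fst.comp (measurable_normalize (n + 1)))
  · exact (measurable_pi_apply n).comp measurable_snd

theorem partialSum_diag {n : ℕ} {g : DGroup} (hg : g ∈ DSub n) (p : ConfigSpace) :
    partialSum (diag g p).2 n = partialSum p.2 n + g := by
  ext i
  rw [Finsupp.add_apply, partialSum_apply, partialSum_apply]
  split_ifs with h
  · rfl
  · rw [mem_DSub.mp hg i (not_lt.mp h), add_zero]

theorem normalize_diag {n : ℕ} {g : DGroup} (hg : g ∈ DSub n) (p : ConfigSpace) :
    normalize n (diag g p) = normalize n p := by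
  rw [normalize, partialSum_diag hg, diag_diag, add_assoc, d_add_self, add_zero, normalize]

/-- Paths that coincide from floor `n` on differ only in their first `n` indices, and the sum of
these indices is the group element relating the images. Conversely, the vertex on floor `k + 1` is
read off from `normalize (k + 1)`, which is constant on the orbits of `DSub (k + 1)`. -/
theorem xi_iff_zeta (n : ℕ) (x y : PathSpace) : xi n x y ↔ zeta n (Psi x) (Psi y) := by
  constructor
  · intro h
    have hg : partialSum (indexSeq x) n + partialSum (indexSeq y) n ∈ DSub n :=
      add_mem (partialSum_mem_DSub _ _) (partialSum_mem_DSub _ _)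
    have hidx : ∀ i, n ≤ i → indexSeq y i = indexSeq x i := fun i hi =>
      congrArg Prod.snd (h i hi).symm
    refine ⟨_, hg, Prod.ext (funext fun k => ?_) (funext fun i => ?_)⟩
    · change configOf y k = configOf x _
      set g := partialSum (indexSeq x) n + partialSum (indexSeq y) n with hgdef
      -- Both configurations are evaluated on a floor that is high enough for `k` and for `k + g`,
      -- and on which the two paths have the same vertex.
      have hk : ∀ i, max n (level k) ≤ i → k i = 0 := fun i hi =>
        level_spec k i ((le_max_right _ _).trans hi)
      have hkg : ∀ i, max n (level k) ≤ i → (k + g) i = 0 := fun i hi => by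
        rw [Finsupp.add_apply, hk i hi, mem_DSub.mp hg i ((le_max_left _ _).trans hi), add_zero]
      rw [configOf_eq y k _ hk, configOf_eq x _ _ hkg, vertexAt, vertexAt,
        h _ (le_max_left _ _), add_assoc]
      congr 2
      ext i
      simp only [hgdef, Finsupp.add_apply, partialSum_apply]
      rcases lt_or_ge i n with hi | hi
      · rw [if_pos hi, if_pos hi, if_pos (hi.trans_le (le_max_left _ _)),
          if_pos (hi.trans_le (le_max_left _ _)), add_right_comm, bit_add_self, zero_add]
      · rw [if_neg (not_lt.mpr hi), if_neg (not_lt.mpr hi), hidx i hi, zero_add, zero_add]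
    · change indexSeq y i = indexSeq x i + _
      rw [Finsupp.add_apply, partialSum_apply, partialSum_apply]
      split_ifs with hi
      · rw [← add_assoc, bit_add_self, zero_add]
      · rw [hidx i (not_lt.mp hi), add_zero, add_zero]
  · rintro ⟨g, hg, hxy⟩ k hk
    rw [← Psi.symm_apply_apply x, ← Psi.symm_apply_apply y, hxy]
    generalize Psi x = p
    refine Prod.ext ?_ ?_
    · exact congrArg (fun q => unlabel (k + 1) q.1)
        (normalize_diag (DSub_mono (hk.trans k.le_succ) hg) p).symm
    · change p.2 k = p.2 k + g k
      rw [mem_DSub.mp hg k hk, add_zero]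

theorem isFiltrationIso_Psi (σ : ℕ → Fin 2) :
    IsFiltrationIso (muSigma σ) xi (omegaSigma σ) zeta Psi where
  forward := by
    refine ⟨measurable_Psi, ?_⟩
    rw [muSigma, Measure.map_map measurable_Psi measurable_Psi_symm]
    simp
  backward := ⟨measurable_Psi_symm, rfl⟩
  rel_iff := xi_iff_zeta

/-! Invariance of the measures -/

instance (J : Type*) : IsProbabilityMeasure (lebesgue J) := by
  unfold lebesgue; infer_instance

theorem measurable_comp_mk (σ : ℕ → Fin 2) :
    Measurable fun (u : DGroup ⧸ DSigma σ → Bit) (g : DGroup) => u (QuotientAddGroup.mk g) :=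
  measurable_pi_lambda _ fun _ => measurable_pi_apply _

instance (σ : ℕ → Fin 2) : IsProbabilityMeasure (mSigma σ) :=
  Measure.isProbabilityMeasure_map (measurable_comp_mk σ).aemeasurable

instance (σ : ℕ → Fin 2) : IsProbabilityMeasure (omegaSigma σ) := by
  unfold omegaSigma; infer_instance

instance (σ : ℕ → Fin 2) : IsProbabilityMeasure (muSigma σ) :=
  Measure.isProbabilityMeasure_map measurable_Psi_symm.aemeasurable

theorem measurePreserving_comp_equiv {J : Type*} (e : J ≃ J) :
    MeasurePreserving (fun (u : J → Bit) i => u (e i)) (lebesgue J) (lebesgue J) := by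
  refine ⟨measurable_pi_lambda _ fun _ => measurable_pi_apply _, ?_⟩
  have h := Measure.infinitePi_map_piCongrLeft
    (fun _ : J => ProbabilityTheory.uniformOn (Set.univ : Set Bit)) e.symm
  have he : (fun (u : J → Bit) i => u (e i)) =
      ⇑(MeasurableEquiv.piCongrLeft (fun _ : J => Bit) e.symm) := by
    funext u i
    have := MeasurableEquiv.piCongrLeft_apply_apply (β := fun _ : J => Bit) e.symm u (e i)
    rw [← this, Equiv.symm_apply_apply]
  rw [lebesgue, he]
  exact h

theorem measurePreserving_add_const {J : Type*} (c : J → Bit) :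
    MeasurePreserving (fun (u : J → Bit) i => u i + c i) (lebesgue J) (lebesgue J) := by
  refine ⟨measurable_pi_lambda _ fun _ => (measurable_pi_apply _).add_const _, ?_⟩
  rw [lebesgue, Measure.infinitePi_map_pi (f := fun i x => x + c i) _ fun _ =>
    measurable_id.add_const _]
  congr 1
  funext i
  ext s hs
  rw [Measure.map_apply (f := fun x => x + c i) (measurable_id.add_const _) hs,
    ← Set.image_add_right',
    ProbabilityTheory.uniformOn_univ, ProbabilityTheory.uniformOn_univ,
    Measure.count_injective_image (add_left_injective _)]

/-- The shift acts on the quotient group as a translation, which only permutes the identically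
distributed coordinates. -/
theorem measurePreserving_shift (σ : ℕ → Fin 2) (g : DGroup) :
    MeasurePreserving (fun (w : DGroup → Bit) h => w (h + g)) (mSigma σ) (mSigma σ) := by
  have hm : Measurable fun (w : DGroup → Bit) h => w (h + g) :=
    measurable_pi_lambda _ fun _ => measurable_pi_apply _
  refine ⟨hm, ?_⟩
  have h := measurePreserving_comp_equiv
    (Equiv.addRight (QuotientAddGroup.mk g : DGroup ⧸ DSigma σ))
  rw [mSigma, Measure.map_map hm (measurable_comp_mk σ)]
  conv_rhs => rw [← h.map_eq, Measure.map_map (measurable_comp_mk σ) h.measurable]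
  rfl

theorem measurePreserving_diag (σ : ℕ → Fin 2) (g : DGroup) :
    MeasurePreserving (diag g) (omegaSigma σ) (omegaSigma σ) :=
  (measurePreserving_shift σ g).prod (measurePreserving_add_const g)

/-- Almost all configurations are invariant under the shifts by the elements of `DSigma σ`. -/
theorem ae_mSigma_invariant (σ : ℕ → Fin 2) :
    ∀ᵐ w ∂mSigma σ, ∀ g ∈ DSigma σ, ∀ h, w (h + g) = w h := by
  have hset : MeasurableSet {w : DGroup → Bit | ∀ g ∈ DSigma σ, ∀ h, w (h + g) = w h} := by
    simp only [Set.ofPred_forall]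
    refine MeasurableSet.iInter fun g => MeasurableSet.iInter fun _ => MeasurableSet.iInter fun h => ?_
    exact measurableSet_eq_fun (measurable_pi_apply _) (measurable_pi_apply _)
  rw [mSigma, ae_map_iff (measurable_comp_mk σ).aemeasurable hset]
  refine Eventually.of_forall fun u g hg h => ?_
  change u _ = u _
  congr 1
  rw [QuotientAddGroup.eq]
  simpa using hg

/-! The orbits -/

theorem diag_injective {g h : DGroup} {p : ConfigSpace} (H : diag g p = diag h p) : g = h := by
  ext i
  exact add_left_cancel (congrFun (congrArg Prod.snd H) i)

theorem zeta_diag_iff {n : ℕ} {g h : DGroup} {p : ConfigSpace} :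
    zeta n (diag g p) (diag h p) ↔ g + h ∈ DSub n := by
  constructor
  · rintro ⟨k, hk, H⟩
    rw [diag_diag] at H
    rw [diag_injective H, add_comm k, d_add_cancel]
    exact hk
  · intro H
    refine ⟨g + h, H, ?_⟩
    rw [diag_diag, add_comm g h, add_assoc, d_add_self, add_zero]

theorem zeta_diag_self {n : ℕ} {g : DGroup} {p : ConfigSpace} :
    zeta n p (diag g p) ↔ g ∈ DSub n := by
  simpa [diag_zero] using zeta_diag_iff (n := n) (g := 0) (h := g) (p := p)

theorem ncard_zeta (n : ℕ) (p : ConfigSpace) (B : Set ConfigSpace) :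
    (({q | zeta n p q ∧ q ∈ B} : Set ConfigSpace).ncard : ℝ≥0∞) =
      ∑ g ∈ dFin n, B.indicator 1 (diag g p) := by
  classical
  have : ({q | zeta n p q ∧ q ∈ B} : Set ConfigSpace) =
      (fun g => diag g p) '' ((dFin n).filter fun g => diag g p ∈ B : Finset DGroup) := by
    ext q
    simp only [Finset.coe_filter, Set.mem_image]
    constructor
    · rintro ⟨⟨g, hg, rfl⟩, hB⟩
      exact ⟨g, ⟨mem_dFin.mpr hg, hB⟩, rfl⟩
    · rintro ⟨g, ⟨hg, hB⟩, rfl⟩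
      exact ⟨⟨g, mem_dFin.mp hg, rfl⟩, hB⟩
  rw [this, Set.ncard_image_of_injective _ fun _ _ => diag_injective, Set.ncard_coe_finset,
    Finset.card_filter, Nat.cast_sum]
  refine Finset.sum_congr rfl fun g _ => ?_
  by_cases h : diag g p ∈ B <;> simp [h]

theorem zeta_succ_cases {n : ℕ} {p q : ConfigSpace} (h : zeta (n + 1) p q) :
    zeta n p q ∨ zeta n (diag (gen n) p) q := by
  obtain ⟨g, hg, rfl⟩ := h
  rw [zeta_diag_iff, zeta_diag_self]
  exact mem_DSub_succ.mp hg

theorem gen_notMem_DSub (n : ℕ) : gen n ∉ DSub n := fun h => by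
  simpa [gen_apply] using mem_DSub.mp h n le_rfl

theorem zeta_mono (n : ℕ) : zeta n ≤ zeta (n + 1) := by
  rintro p q ⟨g, hg, rfl⟩
  exact ⟨g, DSub_mono n.le_succ hg, rfl⟩

/-- Orbits are separated by the coordinates of `normalize n`. For uniformity, every translation by
an element of `DSub n` preserves the measure and the saturated set `A`, so each of the `2 ^ n` terms
of the count integrates to the measure of `A ∩ B`. -/
theorem isDyadicFiltration_zeta (σ : ℕ → Fin 2) : IsDyadicFiltration (omegaSigma σ) zeta where
  points := by
    ext p q
    change (∃ g ∈ DSub 0, q = diag g p) ↔ p = q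
    constructor
    · rintro ⟨g, hg, rfl⟩
      have : g = 0 := Finsupp.ext fun i => mem_DSub.mp hg i (Nat.zero_le i)
      rw [this, diag_zero]
    · rintro rfl
      exact ⟨0, zero_mem _, (diag_zero p).symm⟩
  mono := zeta_mono
  two n p := by
    refine ⟨diag (gen n) p, zeta_diag_self.mpr (gen_mem_DSub_succ n),
      fun h => gen_notMem_DSub n (zeta_diag_self.mp h), fun q => zeta_succ_cases⟩
  measurable n := by
    obtain ⟨c, hc⟩ := exists_surjective_nat (DGroup ⊕ ℕ)
    let b : DGroup ⊕ ℕ → ConfigSpace → Bit := fun j p => Sum.elim p.1 p.2 j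
    have hb : ∀ j, Measurable (b j) := by
      rintro (g | i)
      · exact (measurable_pi_apply g).comp measurable_fst
      · exact (measurable_pi_apply i).comp measurable_snd
    refine ⟨Set.univ, fun i => (fun p => b (c i) (normalize n p)) ⁻¹' {0}, by simp, fun i =>
      ((hb _).comp (measurable_normalize n)) (measurableSet_singleton 0), ?_, ?_⟩
    · rintro i p q ⟨g, hg, rfl⟩
      simp only [Set.mem_preimage, normalize_diag hg]
    · intro p _ q _ H
      have hbit : ∀ x y : Bit, (x = 0 ↔ y = 0) → x = y := by decide
      have hj : ∀ j, b j (normalize n p) = b j (normalize n q) := fun j => by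
        obtain ⟨i, rfl⟩ := hc j
        exact hbit _ _ (H i)
      have heq : normalize n p = normalize n q :=
        Prod.ext (funext fun g => hj (Sum.inl g)) (funext fun i => hj (Sum.inr i))
      have hp : zeta n p (normalize n p) := zeta_diag_self.mpr (partialSum_mem_DSub _ _)
      have hq : zeta n q (normalize n q) := zeta_diag_self.mpr (partialSum_mem_DSub _ _)
      rw [← heq] at hq
      exact (zeta n).trans hp ((zeta n).symm hq)
  count_measurable n B hB := by
    simp only [ncard_zeta]
    exact (Finset.measurable_sum _ fun g _ =>
      (measurable_one.indicator hB).comp (measurable_diag g)).aemeasurable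
  uniform n A B hA hinv hB := by
    have hm : ∀ g, Measurable fun p => B.indicator (1 : ConfigSpace → ℝ≥0∞) (diag g p) := fun g =>
      (measurable_one.indicator hB).comp (measurable_diag g)
    have hg : ∀ g ∈ dFin n, ∫⁻ p in A, B.indicator (1 : ConfigSpace → ℝ≥0∞) (diag g p)
        ∂omegaSigma σ = omegaSigma σ (A ∩ B) := by
      intro g hg
      have h1 : (fun p => B.indicator (1 : ConfigSpace → ℝ≥0∞) (diag g p)) =
          (diag g ⁻¹' B).indicator 1 := rfl
      rw [h1, lintegral_indicator_one (measurable_diag g hB),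
        Measure.restrict_apply (measurable_diag g hB),
        ← (measurePreserving_diag σ g).measure_preimage (hA.inter hB).nullMeasurableSet]
      congr 1
      ext p
      have := hinv p (diag g p) (zeta_diag_self.mpr (mem_dFin.mp hg))
      simp only [Set.mem_inter_iff, Set.mem_preimage, this, and_comm]
    simp only [ncard_zeta, div_eq_mul_inv]
    rw [lintegral_mul_const _ (Finset.measurable_sum _ fun g _ => hm g),
      lintegral_finsetSum _ fun g _ => hm g, Finset.sum_congr rfl hg, Finset.sum_const, card_dFin,
      nsmul_eq_mul, mul_comm, ← mul_assoc]
    push_cast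
    rw [ENNReal.inv_mul_cancel (by simp) (by simp), one_mul]

/-! Averages over orbits -/

/-- The average of a function over the orbit of a point under `DSub n`. -/
def orbitAvg (n : ℕ) (f : ConfigSpace → ℝ) (p : ConfigSpace) : ℝ :=
  (1 / 2 ^ n : ℝ) * ∑ g ∈ dFin n, f (diag g p)

theorem orbitAvg_diag {n : ℕ} {h : DGroup} (hh : h ∈ DSub n) (f : ConfigSpace → ℝ)
    (p : ConfigSpace) : orbitAvg n f (diag h p) = orbitAvg n f p := by
  unfold orbitAvg
  congr 1
  refine Finset.sum_equiv (Equiv.addRight h) (fun g => ?_) fun g _ => ?_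
  · rw [mem_dFin, mem_dFin]
    exact (add_mem_cancel_right hh).symm
  · rw [diag_diag]
    rfl

theorem measurable_orbitAvg {n : ℕ} {f : ConfigSpace → ℝ} (hf : Measurable f) :
    Measurable (orbitAvg n f) :=
  (Finset.measurable_sum _ fun g _ => hf.comp (measurable_diag g)).const_mul _

theorem orbitAvg_nonneg {n : ℕ} {f : ConfigSpace → ℝ} (hf : ∀ p, 0 ≤ f p) (p : ConfigSpace) :
    0 ≤ orbitAvg n f p :=
  mul_nonneg (by positivity) (Finset.sum_nonneg fun _ _ => hf _)

theorem integrable_orbitAvg {σ : ℕ → Fin 2} {n : ℕ} {f : ConfigSpace → ℝ}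
    (hf : Integrable f (omegaSigma σ)) : Integrable (orbitAvg n f) (omegaSigma σ) :=
  (integrable_finsetSum _ fun g _ =>
    (measurePreserving_diag σ g).integrable_comp_of_integrable hf).const_mul _

theorem integral_orbitAvg {σ : ℕ → Fin 2} {n : ℕ} {f : ConfigSpace → ℝ} (hfm : Measurable f)
    (hf : Integrable f (omegaSigma σ)) :
    ∫ p, orbitAvg n f p ∂omegaSigma σ = ∫ p, f p ∂omegaSigma σ := by
  have hi : ∀ g, ∫ p, f (diag g p) ∂omegaSigma σ = ∫ p, f p ∂omegaSigma σ := fun g => by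
    conv_rhs => rw [← (measurePreserving_diag σ g).map_eq]
    rw [integral_map (measurable_diag g).aemeasurable hfm.aestronglyMeasurable]
  unfold orbitAvg
  rw [integral_const_mul, integral_finsetSum (f := fun g p => f (diag g p)) _ fun g _ =>
    (measurePreserving_diag σ g).integrable_comp_of_integrable hf]
  simp only [hi, Finset.sum_const, card_dFin, nsmul_eq_mul]
  push_cast
  field_simp

/-- Markov's inequality for averages over orbits. -/
theorem measure_le_orbitAvg {σ : ℕ → Fin 2} (n : ℕ) {f : ConfigSpace → ℝ} (hfm : Measurable f)
    (hf0 : ∀ p, 0 ≤ f p) (hf : Integrable f (omegaSigma σ)) {a : ℝ} (ha : 0 < a) :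
    omegaSigma σ {p | a ≤ orbitAvg n f p} ≤ ENNReal.ofReal ((∫ p, f p ∂omegaSigma σ) / a) := by
  have h := mul_meas_ge_le_integral_of_nonneg (μ := omegaSigma σ)
    (Eventually.of_forall (orbitAvg_nonneg (n := n) hf0)) (integrable_orbitAvg hf) a
  rw [integral_orbitAvg hfm hf] at h
  refine (ENNReal.le_ofReal_iff_toReal_le (measure_ne_top _ _)
    (div_nonneg (integral_nonneg hf0) ha.le)).mpr ?_
  rw [le_div_iff₀ ha, mul_comm]
  exact h

/-- The elements of an orbit are numbered by the elements of `DSub n`. -/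
def orbitEquiv (n : ℕ) (p : ConfigSpace) : dFin n ≃ Elem zeta n (Quotient.mk (zeta n) p) :=
  Equiv.ofBijective
    (fun g => ⟨diag g p, (Quotient.sound (zeta_diag_self.mpr (mem_dFin.mp g.2))).symm⟩)
    ⟨fun _ _ h => Subtype.ext (diag_injective (congrArg Subtype.val h)), fun ⟨q, hq⟩ => by
      obtain ⟨g, hg, h⟩ := (zeta n).symm (Quotient.exact hq)
      exact ⟨⟨g, mem_dFin.mpr hg⟩, Subtype.ext h.symm⟩⟩

theorem orbitEquiv_apply (n : ℕ) (p : ConfigSpace) (g : dFin n) :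
    (orbitEquiv n p g).1 = diag g p := rfl

instance (n : ℕ) (c : Quotient (zeta n)) : Finite (Elem zeta n c) := by
  induction c using Quotient.inductionOn with
  | h p => exact Finite.of_equiv _ (orbitEquiv n p)

theorem finsum_elem (n : ℕ) (p : ConfigSpace) (f : Elem zeta n (Quotient.mk (zeta n) p) → ℝ) :
    ∑ᶠ x, f x = ∑ g : dFin n, f (orbitEquiv n p g) := by
  rw [← finsum_comp_equiv (orbitEquiv n p), finsum_eq_sum_of_fintype]

theorem finsum_elem_val (n : ℕ) (p : ConfigSpace) (f : ConfigSpace → ℝ) :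
    (1 / 2 ^ n : ℝ) * ∑ᶠ x : Elem zeta n (Quotient.mk (zeta n) p), f x.1 = orbitAvg n f p := by
  rw [finsum_elem, orbitAvg]
  congr 1
  exact Finset.sum_coe_sort (dFin n) fun g => f (diag g p)

/-! The iterated semimetrics on orbits -/

/-- The bijection of two orbits that respects the actions. -/
def orbitIso (n : ℕ) (p q : ConfigSpace) :
    HierarchyIso zeta n (Quotient.mk (zeta n) p) (Quotient.mk (zeta n) q) :=
  ⟨(orbitEquiv n p).symm.trans (orbitEquiv n q), fun k _ x y => by
    obtain ⟨g, rfl⟩ := (orbitEquiv n p).surjective x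
    obtain ⟨h, rfl⟩ := (orbitEquiv n p).surjective y
    simp only [Equiv.trans_apply, Equiv.symm_apply_apply, orbitEquiv_apply, zeta_diag_iff]⟩

theorem bddBelow_kantorovich {ρ : ConfigSpace → ConfigSpace → ℝ} (hρ : ∀ x y, 0 ≤ ρ x y) (n : ℕ)
    (c₁ c₂ : Quotient (zeta n)) :
    BddBelow (Set.range fun φ : HierarchyIso zeta n c₁ c₂ =>
      (1 / 2 ^ n : ℝ) * ∑ᶠ x : Elem zeta n c₁, ρ x.1 (φ.1 x).1) := by
  refine ⟨0, ?_⟩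
  rintro _ ⟨φ, rfl⟩
  exact mul_nonneg (by positivity) (finsum_nonneg fun _ => hρ _ _)

theorem kantorovichIter_le {ρ : ConfigSpace → ConfigSpace → ℝ} (hρ : ∀ x y, 0 ≤ ρ x y) (n : ℕ)
    (p q : ConfigSpace) :
    kantorovichIter zeta ρ n (Quotient.mk _ p) (Quotient.mk _ q) ≤
      (1 / 2 ^ n : ℝ) * ∑ g ∈ dFin n, ρ (diag g p) (diag g q) := by
  refine (ciInf_le (bddBelow_kantorovich hρ n _ _) (orbitIso n p q)).trans_eq ?_
  rw [finsum_elem]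
  congr 1
  rw [← Finset.sum_coe_sort (dFin n)]
  refine Finset.sum_congr rfl fun g _ => ?_
  simp only [orbitIso, Equiv.trans_apply, Equiv.symm_apply_apply, orbitEquiv_apply]

instance (n : ℕ) (c₁ c₂ : Quotient (zeta n)) : Nonempty (HierarchyIso zeta n c₁ c₂) := by
  induction c₁ using Quotient.inductionOn with
  | h p =>
    induction c₂ using Quotient.inductionOn with
    | h q => exact ⟨orbitIso n p q⟩

/-- The same bijection is used for both metrics. It maps one orbit onto the other, so the error
terms add up to the averages of `b` over the two orbits. -/
theorem kantorovichIter_comparison {ρ ρ' : ConfigSpace → ConfigSpace → ℝ}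
    (hρ' : ∀ x y, 0 ≤ ρ' x y) {C : ℝ} (hC : 0 < C) {b : ConfigSpace → ℝ}
    (h : ∀ x y, ρ' x y ≤ C * ρ x y + b x + b y) (n : ℕ) (p q : ConfigSpace) :
    kantorovichIter zeta ρ' n (Quotient.mk _ p) (Quotient.mk _ q) ≤
      C * kantorovichIter zeta ρ n (Quotient.mk _ p) (Quotient.mk _ q) +
        orbitAvg n b p + orbitAvg n b q := by
  rw [add_assoc, ← sub_le_iff_le_add, ← div_le_iff₀' hC]
  refine le_ciInf fun φ => ?_
  rw [div_le_iff₀' hC, sub_le_iff_le_add]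
  refine (ciInf_le (bddBelow_kantorovich hρ' n _ _) φ).trans ?_
  have : Fintype (Elem zeta n (Quotient.mk (zeta n) p)) := Fintype.ofFinite _
  rw [← finsum_elem_val, ← finsum_elem_val, ← finsum_comp_equiv φ.1]
  simp only [finsum_eq_sum_of_fintype]
  rw [← mul_add, mul_left_comm, ← mul_add]
  refine mul_le_mul_of_nonneg_left ?_ (by positivity)
  rw [Finset.mul_sum, ← Finset.sum_add_distrib, ← Finset.sum_add_distrib]
  refine Finset.sum_le_sum fun x _ => ?_
  rw [← add_assoc]
  exact h _ _

/-- The iterated semimetrics on the orbits, computed by the recurrence. -/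
def kant (ρ : ConfigSpace → ConfigSpace → ℝ) : ℕ → ConfigSpace → ConfigSpace → ℝ
  | 0, p, q => ρ p q
  | n + 1, p, q =>
    min ((kant ρ n p q + kant ρ n (diag (gen n) p) (diag (gen n) q)) / 2)
      ((kant ρ n p (diag (gen n) q) + kant ρ n (diag (gen n) p) q) / 2)

/-- A hierarchy-preserving map takes the two halves of an orbit to the two halves of its image,
either straight or crosswise; these are the two options of the minimum in `kant`. The map is defined
on the whole space and constrained only on the orbit of `p`, so the induction hypothesis applies to
each half without restricting the map. -/
theorem le_sum_of_hierarchical (ρ : ConfigSpace → ConfigSpace → ℝ) (n : ℕ) :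
    ∀ (φ : ConfigSpace → ConfigSpace) (p q : ConfigSpace), zeta n q (φ p) →
      (∀ k ≤ n, ∀ x y, zeta n p x → zeta n p y → (zeta k x y ↔ zeta k (φ x) (φ y))) →
      2 ^ n * kant ρ n p q ≤ ∑ g ∈ dFin n, ρ (diag g p) (φ (diag g p)) := by
  induction n with
  | zero =>
    rintro φ p q ⟨g, hg, h⟩ -
    have : g = 0 := Finsupp.ext fun i => mem_DSub.mp hg i (Nat.zero_le i)
    rw [this, diag_zero] at h
    simp [dFin, diag_zero, h, kant]
  | succ n ih =>
    intro φ p q hq hφ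
    have hT : zeta (n + 1) p (diag (gen n) p) := zeta_diag_self.mpr (gen_mem_DSub_succ n)
    have hT' : ¬ zeta n p (diag (gen n) p) := fun h => gen_notMem_DSub n (zeta_diag_self.mp h)
    have hr := (zeta (n + 1)).refl p
    have h1 := (hφ (n + 1) le_rfl _ _ hr hT).mp hT
    have h2 := mt (hφ n n.le_succ _ _ hr hT).mpr hT'
    have hqT : zeta (n + 1) q (φ (diag (gen n) p)) := (zeta (n + 1)).trans hq h1
    have hrestr : ∀ p', zeta (n + 1) p p' → ∀ k ≤ n, ∀ x y, zeta n p' x → zeta n p' y →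
        (zeta k x y ↔ zeta k (φ x) (φ y)) := fun p' hp' k hk x y hx hy =>
      hφ k (hk.trans n.le_succ) x y ((zeta (n + 1)).trans hp' (zeta_mono n hx))
        ((zeta (n + 1)).trans hp' (zeta_mono n hy))
    have hsum : ∑ g ∈ dFin n, ρ (diag (gen n + g) p) (φ (diag (gen n + g) p)) =
        ∑ g ∈ dFin n, ρ (diag g (diag (gen n) p)) (φ (diag g (diag (gen n) p))) :=
      Finset.sum_congr rfl fun g _ => by rw [diag_diag, add_comm]
    rw [sum_dFin_succ, hsum, kant, pow_succ, mul_assoc]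
    have hTT : diag (gen n) (diag (gen n) q) = q := by rw [diag_diag, d_add_self, diag_zero]
    rcases zeta_succ_cases hq with hc | hc
    · have hd : zeta n (diag (gen n) q) (φ (diag (gen n) p)) :=
        (zeta_succ_cases hqT).resolve_left fun h =>
          h2 ((zeta n).trans ((zeta n).symm hc) h)
      have e1 := ih φ p q hc (hrestr p hr)
      have e2 := ih φ (diag (gen n) p) (diag (gen n) q) hd (hrestr _ hT)
      refine le_trans (mul_le_mul_of_nonneg_left (mul_le_mul_of_nonneg_left (min_le_left _ _)
        zero_le_two) (by positivity)) ?_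
      linarith
    · have hd : zeta n q (φ (diag (gen n) p)) :=
        (zeta_succ_cases hqT).resolve_right fun h =>
          h2 ((zeta n).trans ((zeta n).symm hc) h)
      have e1 := ih φ p (diag (gen n) q) hc (hrestr p hr)
      have e2 := ih φ (diag (gen n) p) q hd (hrestr _ hT)
      refine le_trans (mul_le_mul_of_nonneg_left (mul_le_mul_of_nonneg_left (min_le_right _ _)
        zero_le_two) (by positivity)) ?_
      linarith

theorem kant_le_kantorovichIter (ρ : ConfigSpace → ConfigSpace → ℝ) (n : ℕ) (p q : ConfigSpace) :
    kant ρ n p q ≤ kantorovichIter zeta ρ n (Quotient.mk _ p) (Quotient.mk _ q) := by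
  classical
  refine le_ciInf fun φ => ?_
  -- The extension by the identity is arbitrary: only the values on the orbit of `p` enter.
  let ψ : ConfigSpace → ConfigSpace := fun x =>
    if h : Quotient.mk (zeta n) x = Quotient.mk (zeta n) p then (φ.1 ⟨x, h⟩).1 else x
  have hψ : ∀ x : Elem zeta n (Quotient.mk (zeta n) p), ψ x.1 = (φ.1 x).1 := fun x =>
    dif_pos x.2
  have hmem : ∀ x, zeta n p x → Quotient.mk (zeta n) x = Quotient.mk (zeta n) p := fun x hx =>
    (Quotient.sound hx).symm
  have h := le_sum_of_hierarchical ρ n ψ p q ?_ ?_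
  · rw [finsum_elem, one_div_mul_eq_div, le_div_iff₀' (by positivity)]
    refine h.trans_eq ?_
    rw [← Finset.sum_coe_sort (dFin n)]
    refine Finset.sum_congr rfl fun g _ => ?_
    rw [← hψ]
    rfl
  · rw [hψ ⟨p, rfl⟩]
    exact (zeta n).symm (Quotient.exact (φ.1 ⟨p, rfl⟩).2)
  · intro k hk x y hx hy
    rw [hψ ⟨x, hmem x hx⟩, hψ ⟨y, hmem y hy⟩]
    exact φ.2 k hk ⟨x, hmem x hx⟩ ⟨y, hmem y hy⟩

/-! Independence of blocks -/

/-- The function depends only on the restriction of a configuration to `DSub n`. -/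
def DependsOnBlock {β : Type*} (n : ℕ) (F : (DGroup → Bit) → β) : Prop :=
  ∀ w w' : DGroup → Bit, (∀ h ∈ DSub n, w h = w' h) → F w = F w'

theorem DependsOnBlock.measurable {β : Type*} [MeasurableSpace β] {n : ℕ}
    {F : (DGroup → Bit) → β} (hF : DependsOnBlock n F) : Measurable F :=
  measurable_of_agree (dFin n) fun u v h => hF u v fun g hg => h g (mem_dFin.mpr hg)

theorem integral_mSigma {σ : ℕ → Fin 2} {F : (DGroup → Bit) → ℝ} (hF : Measurable F) :
    ∫ w, F w ∂mSigma σ =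
      ∫ u, F (fun g => u (QuotientAddGroup.mk g)) ∂lebesgue (DGroup ⧸ DSigma σ) := by
  rw [mSigma, integral_map (measurable_comp_mk σ).aemeasurable hF.aestronglyMeasurable]

theorem integral_shift {σ : ℕ → Fin 2} (g : DGroup) {F : (DGroup → Bit) → ℝ} (hF : Measurable F) :
    ∫ w, F (fun h => w (h + g)) ∂mSigma σ = ∫ w, F w ∂mSigma σ := by
  have h := measurePreserving_shift σ g
  conv_rhs => rw [← h.map_eq]
  rw [integral_map h.measurable.aemeasurable hF.aestronglyMeasurable]

/-- For `σ n = 1` coordinate `n` is well defined on `DGroup ⧸ DSigma σ`, so `DSub n` and its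
translate by `gen n` have disjoint images there. The two factors then depend on disjoint sets of
independent coordinates. -/
theorem integral_mul_shift {σ : ℕ → Fin 2} {n : ℕ} (hσ : σ n = 1) {F G : (DGroup → Bit) → ℝ}
    (hF : DependsOnBlock n F) (hG : DependsOnBlock n G) :
    ∫ w, F w * G (fun h => w (h + gen n)) ∂mSigma σ =
      (∫ w, F w ∂mSigma σ) * ∫ w, G w ∂mSigma σ := by
  classical
  have hGs : Measurable fun w : DGroup → Bit => G fun h => w (h + gen n) :=
    hG.measurable.comp (measurePreserving_shift σ (gen n)).measurable
  rw [← integral_shift (gen n) hG.measurable, integral_mSigma hF.measurable, integral_mSigma hGs,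
    integral_mSigma (F := fun w => F w * G fun h => w (h + gen n)) (hF.measurable.mul hGs)]
  let π : DGroup → DGroup ⧸ DSigma σ := QuotientAddGroup.mk
  let S := (dFin n).image π
  let T := (dFin n).image fun g => π (g + gen n)
  have hST : Disjoint S T := by
    rw [Finset.disjoint_left]
    intro q hq hq'
    obtain ⟨g, hg, rfl⟩ := Finset.mem_image.mp hq
    obtain ⟨h, hh, H⟩ := Finset.mem_image.mp hq'
    have h1 := mem_DSigma.mp (QuotientAddGroup.eq.mp H) n hσ
    have h2 := mem_DSub.mp (mem_dFin.mp hg) n le_rfl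
    have h3 := mem_DSub.mp (mem_dFin.mp hh) n le_rfl
    simp [gen_apply, h2, h3] at h1
  have hind : ProbabilityTheory.iIndepFun
      (fun (q : DGroup ⧸ DSigma σ) (u : DGroup ⧸ DSigma σ → Bit) => u q) (lebesgue _) :=
    ProbabilityTheory.iIndepFun_infinitePi (X := fun _ b => b) fun _ => measurable_id
  have hIndep := hind.indepFun_finset S T hST fun q => measurable_pi_apply q
  -- The default value `0` is never read on `DSub n`, and `F` looks nowhere else.
  let F' : (S → Bit) → ℝ := fun v => F fun g => if h : π g ∈ S then v ⟨π g, h⟩ else 0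
  let G' : (T → Bit) → ℝ := fun v => G fun g =>
    if h : π (g + gen n) ∈ T then v ⟨π (g + gen n), h⟩ else 0
  have hF' : ∀ u : DGroup ⧸ DSigma σ → Bit, F (fun g => u (π g)) = F' fun i => u i := fun u =>
    hF _ _ fun h hh => by
      rw [dif_pos (Finset.mem_image_of_mem π (mem_dFin.mpr hh))]
  have hG' : ∀ u : DGroup ⧸ DSigma σ → Bit, G (fun g => u (π (g + gen n))) = G' fun i => u i :=
    fun u => hG _ _ fun h hh => by
      rw [dif_pos (Finset.mem_image_of_mem (fun g => π (g + gen n)) (mem_dFin.mpr hh))]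
  have hFm : Measurable F' := measurable_of_finite _
  have hGm : Measurable G' := measurable_of_finite _
  have hc := hIndep.comp hFm hGm
  have hmS : Measurable fun (u : DGroup ⧸ DSigma σ → Bit) (i : S) => u i :=
    measurable_pi_lambda _ fun i => measurable_pi_apply _
  have hmT : Measurable fun (u : DGroup ⧸ DSigma σ → Bit) (i : T) => u i :=
    measurable_pi_lambda _ fun i => measurable_pi_apply _
  have := hc.integral_fun_mul_eq_mul_integral (hFm.comp hmS).aestronglyMeasurable
    (hGm.comp hmT).aestronglyMeasurable
  simp only [Function.comp_apply, ← hF', ← hG'] at this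
  exact this

/-! A semimetric with large balls of small measure -/

/-- The configurations at zero and the first `N` indices of two points coincide. -/
def AgreeAt (N : ℕ) (p q : ConfigSpace) : Prop := p.1 0 = q.1 0 ∧ ∀ i < N, p.2 i = q.2 i

open Classical in
/-- The semimetric that distinguishes points by the value of the configuration at zero and by the
first `N` indices. -/
def cutMetric (N : ℕ) (p q : ConfigSpace) : ℝ := if AgreeAt N p q then 0 else 1

theorem cutMetric_nonneg (N : ℕ) (p q : ConfigSpace) : 0 ≤ cutMetric N p q := by
  unfold cutMetric; split_ifs <;> norm_num

theorem cutMetric_le_one (N : ℕ) (p q : ConfigSpace) : cutMetric N p q ≤ 1 := by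
  unfold cutMetric; split_ifs <;> norm_num

theorem kant_cutMetric_nonneg (N n : ℕ) : ∀ p q, 0 ≤ kant (cutMetric N) n p q := by
  induction n with
  | zero => exact cutMetric_nonneg N
  | succ n ih =>
    intro p q
    exact le_min (by linarith [ih p q, ih (diag (gen n) p) (diag (gen n) q)])
      (by linarith [ih p (diag (gen n) q), ih (diag (gen n) p) q])

theorem kant_cutMetric_le_one (N n : ℕ) : ∀ p q, kant (cutMetric N) n p q ≤ 1 := by
  induction n with
  | zero => exact cutMetric_le_one N
  | succ n ih =>
    intro p q
    exact min_le_of_left_le (by linarith [ih p q, ih (diag (gen n) p) (diag (gen n) q)])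

/-- It makes the distance a function of a finite block of `w`; from floor `N` on, it also makes the
distance blind to the action of `gen n` on the indices. -/
theorem kant_cutMetric_congr (N n : ℕ) : ∀ {p p' : ConfigSpace},
    (∀ h ∈ DSub n, p.1 h = p'.1 h) → (∀ i < N, p.2 i = p'.2 i) → ∀ q,
    kant (cutMetric N) n p q = kant (cutMetric N) n p' q := by
  induction n with
  | zero =>
    intro p p' h1 h2 q
    have : AgreeAt N p q ↔ AgreeAt N p' q := by
      unfold AgreeAt
      rw [h1 0 (zero_mem _)]
      exact and_congr_right fun _ => forall₂_congr fun i hi => by rw [h2 i hi]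
    unfold kant cutMetric
    by_cases h : AgreeAt N p q
    · rw [if_pos h, if_pos (this.mp h)]
    · rw [if_neg h, if_neg (mt this.mpr h)]
  | succ n ih =>
    intro p p' h1 h2 q
    have e1 : ∀ h ∈ DSub n, p.1 h = p'.1 h := fun h hh => h1 h (DSub_mono n.le_succ hh)
    have e2 : ∀ h ∈ DSub n, (diag (gen n) p).1 h = (diag (gen n) p').1 h := fun h hh =>
      h1 _ (add_mem (DSub_mono n.le_succ hh) (gen_mem_DSub_succ n))
    have e3 : ∀ i < N, (diag (gen n) p).2 i = (diag (gen n) p').2 i := fun i hi =>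
      congrArg (· + gen n i) (h2 i hi)
    simp only [kant, ih e1 h2, ih e2 e3]

/-- The first `n` generators do not touch index `i`, so a disagreement there persists between all
points of the two orbits. -/
theorem kant_cutMetric_eq_one (N n : ℕ) {i : ℕ} (hni : n ≤ i) (hiN : i < N) :
    ∀ {p q : ConfigSpace}, p.2 i ≠ q.2 i → kant (cutMetric N) n p q = 1 := by
  induction n with
  | zero =>
    intro p q h
    exact if_neg fun H => h (H.2 i hiN)
  | succ n ih =>
    intro p q h
    have hT : ∀ p : ConfigSpace, (diag (gen n) p).2 i = p.2 i := fun p => by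
      simp [diag, gen_apply, show n ≠ i by omega]
    have ih' := fun {p q : ConfigSpace} => @ih (by omega) p q
    rw [kant, ih' h, ih' (by rwa [hT, hT]), ih' (by rwa [hT]), ih' (by rwa [hT])]
    norm_num

/-- In the first `N` steps the optimal coupling is determined by the indices. -/
theorem kant_cutMetric_succ_of_lt {N n : ℕ} (hn : n < N) (α : ℕ → Bit) (q : ConfigSpace) :
    ∃ q' q'', ∀ w, kant (cutMetric N) (n + 1) (w, α) q =
      (kant (cutMetric N) n (w, α) q' + kant (cutMetric N) n (diag (gen n) (w, α)) q'') / 2 := by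
  have hT : ∀ p : ConfigSpace, (diag (gen n) p).2 n = p.2 n + 1 := fun p => by
    simp [diag, gen_apply]
  have hne : ∀ b : Bit, b ≠ b + 1 := by decide
  -- The coupling that mismatches index `n` costs 1, the maximum, so the other one is optimal. The
  -- choice depends on `α` and `q` but not on `w`, which allows integration over `w`.
  by_cases h : α n = q.2 n
  · refine ⟨q, diag (gen n) q, fun w => ?_⟩
    rw [kant, kant_cutMetric_eq_one N n le_rfl hn (p := (w, α)) (q := diag (gen n) q),
      kant_cutMetric_eq_one N n le_rfl hn (p := diag (gen n) (w, α)) (q := q)]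
    · refine min_eq_left ?_
      linarith [kant_cutMetric_le_one N n (w, α) q,
        kant_cutMetric_le_one N n (diag (gen n) (w, α)) (diag (gen n) q)]
    · rw [hT]
      exact h ▸ (hne (α n)).symm
    · rw [hT]
      exact h ▸ hne (α n)
  · refine ⟨diag (gen n) q, q, fun w => ?_⟩
    rw [kant, kant_cutMetric_eq_one N n le_rfl hn (p := (w, α)) (q := q) h,
      kant_cutMetric_eq_one N n le_rfl hn (p := diag (gen n) (w, α)) (q := diag (gen n) q)]
    · refine min_eq_right ?_
      linarith [kant_cutMetric_le_one N n (w, α) (diag (gen n) q),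
        kant_cutMetric_le_one N n (diag (gen n) (w, α)) q]
    · rw [hT, hT]
      exact fun H => h (add_right_cancel H)

/-! ### Exponential moments of the distance to a point -/

/-- The number of indices `i < n` with `σ i = 1`. -/
def ones (σ : ℕ → Fin 2) (n : ℕ) : ℕ := ∑ i ∈ Finset.range n, (σ i : ℕ)

theorem ones_succ_of_zero {σ : ℕ → Fin 2} {n : ℕ} (h : σ n = 0) : ones σ (n + 1) = ones σ n := by
  simp [ones, Finset.sum_range_succ, h]

theorem ones_succ_of_one {σ : ℕ → Fin 2} {n : ℕ} (h : σ n = 1) :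
    ones σ (n + 1) = ones σ n + 1 := by
  simp [ones, Finset.sum_range_succ, h]

/-- The exponential weight of the scaled distance to a point. -/
def expKant (σ : ℕ → Fin 2) (N : ℕ) (t : ℝ) (n : ℕ) (α : ℕ → Bit) (q : ConfigSpace)
    (w : DGroup → Bit) : ℝ :=
  Real.exp (-(t * 2 ^ ones σ n * kant (cutMetric N) n (w, α) q))

section

variable {σ : ℕ → Fin 2} {N n : ℕ} {t : ℝ}

theorem dependsOnBlock_expKant (α : ℕ → Bit) (q : ConfigSpace) :
    DependsOnBlock n (expKant σ N t n α q) := fun w w' h => by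
  unfold expKant
  rw [kant_cutMetric_congr N n (p := (w, α)) (p' := (w', α)) h (fun _ _ => rfl)]

theorem measurable_expKant (α : ℕ → Bit) (q : ConfigSpace) :
    Measurable (expKant σ N t n α q) := (dependsOnBlock_expKant α q).measurable

theorem expKant_pos (α : ℕ → Bit) (q : ConfigSpace) (w : DGroup → Bit) :
    0 < expKant σ N t n α q w := Real.exp_pos _

theorem expKant_le_one (ht : 0 ≤ t) (α : ℕ → Bit) (q : ConfigSpace) (w : DGroup → Bit) :
    expKant σ N t n α q w ≤ 1 := by
  rw [expKant, Real.exp_le_one_iff, neg_nonpos]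
  have := kant_cutMetric_nonneg N n (w, α) q
  positivity

theorem integrable_of_measurable_of_bound {F : (DGroup → Bit) → ℝ} (hF : Measurable F)
    (h0 : ∀ w, 0 ≤ F w) (h1 : ∀ w, F w ≤ 1) : Integrable F (mSigma σ) :=
  Integrable.of_bound hF.aestronglyMeasurable 1
    (Eventually.of_forall fun w => by rw [Real.norm_of_nonneg (h0 w)]; exact h1 w)

theorem integrable_expKant (ht : 0 ≤ t) (α : ℕ → Bit) (q : ConfigSpace) :
    Integrable (expKant σ N t n α q) (mSigma σ) :=
  integrable_of_measurable_of_bound (measurable_expKant α q) (fun w => (expKant_pos α q w).le)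
    (expKant_le_one ht α q)

/-- The indices after the action of the generator `gen n`. -/
def flipAt (n : ℕ) (α : ℕ → Bit) : ℕ → Bit := fun i => α i + gen n i

theorem expKant_diag (α : ℕ → Bit) (q : ConfigSpace) (w : DGroup → Bit) :
    expKant σ N t n (flipAt n α) q (fun h => w (h + gen n)) =
      Real.exp (-(t * 2 ^ ones σ n * kant (cutMetric N) n (diag (gen n) (w, α)) q)) := rfl

/-- Convexity of the exponential, which keeps the moments from growing at the steps with `σ n = 0`.
-/
theorem exp_half_sum_le (x y : ℝ) :
    Real.exp (-((x + y) / 2)) ≤ (Real.exp (-x) + Real.exp (-y)) / 2 := by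
  have h1 : Real.exp (-((x + y) / 2)) = Real.exp (-x / 2) * Real.exp (-y / 2) := by
    rw [← Real.exp_add]; ring_nf
  have h2 : ∀ z : ℝ, Real.exp (-z) = Real.exp (-z / 2) ^ 2 := fun z => by
    rw [← Real.exp_nat_mul]; ring_nf
  rw [h1, h2 x, h2 y]
  nlinarith [sq_nonneg (Real.exp (-x / 2) - Real.exp (-y / 2))]

theorem integrable_expKant_shift (ht : 0 ≤ t) (α : ℕ → Bit) (q : ConfigSpace) (g : DGroup) :
    Integrable (fun w => expKant σ N t n α q fun h => w (h + g)) (mSigma σ) :=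
  (measurePreserving_shift σ g).integrable_comp_of_integrable (integrable_expKant ht α q)

theorem integral_expKant_mul_shift_le {M : ℝ} (hσ : σ n = 1)
    (hM : ∀ α q, ∫ w, expKant σ N t n α q w ∂mSigma σ ≤ M) (α : ℕ → Bit) (q q' : ConfigSpace) :
    ∫ w, expKant σ N t n α q w * expKant σ N t n (flipAt n α) q' (fun h => w (h + gen n))
      ∂mSigma σ ≤ M ^ 2 := by
  have h0 : ∀ α q, 0 ≤ ∫ w, expKant σ N t n α q w ∂mSigma σ := fun α q =>
    integral_nonneg fun w => (expKant_pos α q w).le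
  rw [integral_mul_shift hσ (dependsOnBlock_expKant α q) (dependsOnBlock_expKant _ q'), sq]
  exact mul_le_mul (hM _ _) (hM _ _) (h0 _ _) ((h0 _ _).trans (hM α q))

/-- Only the bit at zero is used: a disagreement there costs 1. The flip of all bits preserves the
measure and exchanges agreement with disagreement, so each has probability one half. -/
theorem integral_expKant_zero_le (ht : 0 ≤ t) (α : ℕ → Bit) (q : ConfigSpace) :
    ∫ w, expKant σ N t 0 α q w ∂mSigma σ ≤ (1 + Real.exp (-t)) / 2 := by
  have hmeas : Measurable fun b : Bit => if b = q.1 0 then (1 : ℝ) else Real.exp (-t) :=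
    measurable_of_finite _
  set f : Bit → ℝ := fun b => if b = q.1 0 then (1 : ℝ) else Real.exp (-t) with hf
  have hexp : Real.exp (-t) ≤ 1 := by rw [Real.exp_le_one_iff]; linarith
  have hf0 : ∀ b, 0 ≤ f b := fun b => by
    simp only [hf]; split_ifs
    · exact zero_le_one
    · exact (Real.exp_pos _).le
  have hf1 : ∀ b, f b ≤ 1 := fun b => by
    simp only [hf]; split_ifs
    · exact le_rfl
    · exact hexp
  have hfm : Measurable fun w : DGroup → Bit => f (w 0) := hmeas.comp (measurable_pi_apply 0)
  have hle : ∫ w, expKant σ N t 0 α q w ∂mSigma σ ≤ ∫ w, f (w 0) ∂mSigma σ := by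
    refine integral_mono (integrable_expKant ht α q)
      (integrable_of_measurable_of_bound hfm (fun _ => hf0 _) fun _ => hf1 _) fun w => ?_
    by_cases h : w 0 = q.1 0
    · simp only [hf, h, if_true]
      exact expKant_le_one ht α q w
    · have : kant (cutMetric N) 0 (w, α) q = 1 := if_neg fun H => h H.1
      simp only [hf, h, if_false, expKant, this]
      simp [ones]
  refine hle.trans_eq ?_
  rw [integral_mSigma hfm]
  have hlm : Measurable fun u : DGroup ⧸ DSigma σ → Bit => f (u (QuotientAddGroup.mk 0)) :=
    hmeas.comp (measurable_pi_apply _)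
  have hli : Integrable (fun u : DGroup ⧸ DSigma σ → Bit => f (u (QuotientAddGroup.mk 0)))
      (lebesgue _) :=
    Integrable.of_bound hlm.aestronglyMeasurable 1 (Eventually.of_forall fun w => by
      rw [Real.norm_of_nonneg (hf0 _)]; exact hf1 _)
  have hflip := measurePreserving_add_const (fun _ : DGroup ⧸ DSigma σ => (1 : Bit))
  have h2 : ∫ u, f (u (QuotientAddGroup.mk 0) + 1) ∂lebesgue (DGroup ⧸ DSigma σ) =
      ∫ u, f (u (QuotientAddGroup.mk 0)) ∂lebesgue (DGroup ⧸ DSigma σ) := by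
    conv_rhs => rw [← hflip.map_eq]
    rw [integral_map hflip.measurable.aemeasurable hlm.aestronglyMeasurable]
  have hsum : ∀ b : Bit, f b + f (b + 1) = 1 + Real.exp (-t) := by
    have hb : ∀ b c : Bit, b = c ∨ (b ≠ c ∧ b + 1 = c) := by decide
    have hb' : ∀ c : Bit, c + 1 ≠ c := by decide
    intro b
    simp only [hf]
    rcases hb b (q.1 0) with h | ⟨h, h'⟩
    · rw [h, if_pos rfl, if_neg (hb' _)]
    · rw [if_neg h, if_pos h', add_comm]
  have h3 : ∫ u, (f (u (QuotientAddGroup.mk 0)) + f (u (QuotientAddGroup.mk 0) + 1))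
      ∂lebesgue (DGroup ⧸ DSigma σ) = 1 + Real.exp (-t) := by
    simp only [hsum, integral_const, probReal_univ, one_smul]
  have hli' : Integrable (fun u : DGroup ⧸ DSigma σ → Bit => f (u (QuotientAddGroup.mk 0) + 1))
      (lebesgue _) := hflip.integrable_comp_of_integrable hli
  rw [integral_add hli hli', h2] at h3
  change ∫ u, f (u (QuotientAddGroup.mk 0)) ∂lebesgue (DGroup ⧸ DSigma σ) = _
  linarith

/-- The coupling is forced. If `σ n = 1`, the doubled weight cancels the division by two, and the
exponential of the sum is a product over independent blocks. If `σ n = 0`, the weight is unchanged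
and convexity with shift invariance suffices. -/
theorem integral_expKant_succ_of_lt (ht : 0 ≤ t) (hn : n < N) {M : ℝ}
    (hM : ∀ α q, ∫ w, expKant σ N t n α q w ∂mSigma σ ≤ M) (α : ℕ → Bit) (q : ConfigSpace) :
    ∫ w, expKant σ N t (n + 1) α q w ∂mSigma σ ≤ if σ n = 1 then M ^ 2 else M := by
  obtain ⟨q', q'', hq⟩ := kant_cutMetric_succ_of_lt hn α q
  split_ifs with hσ
  · refine le_trans (le_of_eq (integral_congr_ae (Eventually.of_forall fun w => ?_)))
      (integral_expKant_mul_shift_le hσ hM α q' q'')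
    simp only [expKant_diag]
    rw [expKant, expKant, ← Real.exp_add, hq, ones_succ_of_one hσ]
    congr 1
    ring
  · have hσ0 : σ n = 0 := by omega
    have hle : ∫ w, expKant σ N t (n + 1) α q w ∂mSigma σ ≤ ∫ w, (expKant σ N t n α q' w +
        expKant σ N t n (flipAt n α) q'' (fun h => w (h + gen n))) / 2 ∂mSigma σ := by
      refine integral_mono (integrable_expKant ht α q) (((integrable_expKant ht α q').add
        (integrable_expKant_shift ht _ q'' _)).div_const 2) fun w => ?_
      simp only [expKant_diag]
      rw [expKant, expKant, hq, ones_succ_of_zero hσ0]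
      refine le_trans (le_of_eq ?_) (exp_half_sum_le _ _)
      congr 1
      ring
    rw [integral_div, integral_add (integrable_expKant ht α q') (integrable_expKant_shift ht _ q'' _),
      integral_shift _ (measurable_expKant _ q'')] at hle
    linarith [hM α q', hM (flipAt n α) q'']

/-- If `σ n = 1`, the exponential of minus a minimum is at most the sum over both couplings, whence
the factor 2. If `σ n = 0`, this factor must be avoided: an invariant `w` and unchanged first `N`
indices make the two halves of the orbit indistinguishable, so both couplings cost the same. -/
theorem integral_expKant_succ_of_ge (ht : 0 ≤ t) (hn : N ≤ n) {M : ℝ}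
    (hM : ∀ α q, ∫ w, expKant σ N t n α q w ∂mSigma σ ≤ M) (α : ℕ → Bit) (q : ConfigSpace) :
    ∫ w, expKant σ N t (n + 1) α q w ∂mSigma σ ≤ if σ n = 1 then 2 * M ^ 2 else M := by
  split_ifs with hσ
  · have hprod : ∀ q q', Integrable (fun w => expKant σ N t n α q w *
        expKant σ N t n (flipAt n α) q' (fun h => w (h + gen n))) (mSigma σ) := fun q q' =>
      integrable_of_measurable_of_bound ((measurable_expKant α q).mul
        ((measurable_expKant _ q').comp (measurePreserving_shift σ (gen n)).measurable))
        (fun w => mul_nonneg (expKant_pos _ _ _).le (expKant_pos _ _ _).le)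
        (fun w => mul_le_one₀ (expKant_le_one ht _ _ _) (expKant_pos _ _ _).le
          (expKant_le_one ht _ _ _))
    have hle := integral_mono (integrable_expKant (σ := σ) (N := N) (n := n + 1) ht α q)
      ((hprod q (diag (gen n) q)).add (hprod (diag (gen n) q) q)) fun w => by
        simp only [Pi.add_apply, expKant_diag]
        simp only [expKant, ← Real.exp_add, kant, ones_succ_of_one hσ]
        rcases min_choice ((kant (cutMetric N) n (w, α) q +
            kant (cutMetric N) n (diag (gen n) (w, α)) (diag (gen n) q)) / 2)
          ((kant (cutMetric N) n (w, α) (diag (gen n) q) +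
            kant (cutMetric N) n (diag (gen n) (w, α)) q) / 2) with h | h
        · rw [h]
          refine le_trans (le_of_eq ?_) (le_add_of_nonneg_right (Real.exp_pos _).le)
          congr 1
          ring
        · rw [h]
          refine le_trans (le_of_eq ?_) (le_add_of_nonneg_left (Real.exp_pos _).le)
          congr 1
          ring
    rw [Pi.add_def, integral_add (hprod q (diag (gen n) q)) (hprod (diag (gen n) q) q)] at hle
    linarith [integral_expKant_mul_shift_le hσ hM α q (diag (gen n) q),
      integral_expKant_mul_shift_le hσ hM α (diag (gen n) q) q]
  · have hσ0 : σ n = 0 := by omega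
    have hle : ∫ w, expKant σ N t (n + 1) α q w ∂mSigma σ ≤ ∫ w, (expKant σ N t n α q w +
        expKant σ N t n α (diag (gen n) q) w) / 2 ∂mSigma σ := by
      refine integral_mono_ae (integrable_expKant ht α q) (((integrable_expKant ht α q).add
        (integrable_expKant ht α _)).div_const 2) ?_
      filter_upwards [ae_mSigma_invariant σ] with w hw
      have hgen : gen n ∈ DSigma σ := AddSubgroup.subset_closure ⟨n, hσ0, rfl⟩
      have hT : ∀ q, kant (cutMetric N) n (diag (gen n) (w, α)) q =
          kant (cutMetric N) n (w, α) q := kant_cutMetric_congr N n (fun h _ => hw _ hgen h)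
        fun i hi => by simp [diag, gen_apply, show n ≠ i by omega]
      simp only [expKant, kant, hT, ones_succ_of_zero hσ0]
      rw [add_comm (kant _ n _ (diag (gen n) q)), min_self]
      refine le_trans (le_of_eq ?_) (exp_half_sum_le _ _)
      congr 1
      ring
    rw [integral_div, integral_add (integrable_expKant ht α q) (integrable_expKant ht α _)] at hle
    linarith [hM α q, hM α (diag (gen n) q)]

end

theorem integral_expKant_le_of_le {σ : ℕ → Fin 2} {N : ℕ} {t : ℝ} (ht : 0 ≤ t) (n : ℕ) (hn : n ≤ N) :
    ∀ α q, ∫ w, expKant σ N t n α q w ∂mSigma σ ≤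
      ((1 + Real.exp (-t)) / 2) ^ 2 ^ ones σ n := by
  induction n with
  | zero => simpa [ones] using fun α q => integral_expKant_zero_le ht α q
  | succ n ih =>
    intro α q
    have := integral_expKant_succ_of_lt ht hn (ih (by omega)) α q
    split_ifs at this with hσ
    · rwa [ones_succ_of_one hσ, pow_succ 2, pow_mul]
    · rwa [ones_succ_of_zero (by omega)]

/-- For a suitable semimetric, the exponential weights have small integrals. -/
theorem exists_integral_expKant_le (σ : ℕ → Fin 2) :
    ∃ N, ∀ n ≥ N, ∀ α q, ∫ w, expKant σ N (Real.log 5) n α q w ∂mSigma σ ≤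
      (9 / 10 : ℝ) ^ 2 ^ ones σ n := by
  have ht : 0 ≤ Real.log 5 := Real.log_nonneg (by norm_num)
  have hexp : (1 + Real.exp (-Real.log 5)) / 2 = 3 / 5 := by
    rw [Real.exp_neg, Real.exp_log (by norm_num)]
    norm_num
  by_cases h : ∃ j, σ j = 1
  · obtain ⟨j, hj⟩ := h
    refine ⟨j + 1, fun n hn => ?_⟩
    -- The halved bound reproduces itself under `M ↦ 2 * M ^ 2`, since `2 * (A / 2) ^ 2 = A ^ 2 /
    -- 2`. At floor `j + 1` at least one squaring has occurred, and `(3 / 2) ^ 2 ≥ 2` leaves room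
    -- for the half.
    have key : ∀ α q, ∫ w, expKant σ (j + 1) (Real.log 5) n α q w ∂mSigma σ ≤
        (9 / 10 : ℝ) ^ 2 ^ ones σ n / 2 := by
      induction n, hn using Nat.le_induction with
      | base =>
        intro α q
        refine (integral_expKant_le_of_le ht (j + 1) le_rfl α q).trans ?_
        rw [hexp, ones_succ_of_one hj]
        have h2 : 2 ≤ 2 ^ (ones σ j + 1) := by
          rw [pow_succ]
          exact Nat.le_mul_of_pos_left 2 (by positivity)
        have h3 : (2 : ℝ) ≤ (3 / 2) ^ 2 ^ (ones σ j + 1) :=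
          le_trans (by norm_num) (pow_le_pow_right₀ (by norm_num) h2)
        have h4 : (9 / 10 : ℝ) = 3 / 5 * (3 / 2) := by norm_num
        rw [h4, mul_pow]
        have h5 : (0 : ℝ) < (3 / 5) ^ 2 ^ (ones σ j + 1) := by positivity
        nlinarith
      | succ n hn ih =>
        intro α q
        have := integral_expKant_succ_of_ge ht hn ih α q
        split_ifs at this with hσ
        · rw [ones_succ_of_one hσ, pow_succ 2, pow_mul]
          linarith
        · rwa [ones_succ_of_zero (by omega)]
    intro α q
    have : (0 : ℝ) < (9 / 10 : ℝ) ^ 2 ^ ones σ n := by positivity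
    linarith [key α q]
  · push Not at h
    have h0 : ∀ j, σ j = 0 := fun j => by have := h j; omega
    have hones : ∀ n, ones σ n = 0 := fun n => by simp [ones, h0]
    refine ⟨0, fun n _ => ?_⟩
    -- Here no step has `σ n = 1`, so the factor 2 never appears and `N = 0` is enough.
    have key : ∀ α q, ∫ w, expKant σ 0 (Real.log 5) n α q w ∂mSigma σ ≤ 3 / 5 := by
      induction n with
      | zero => exact fun α q => hexp ▸ integral_expKant_zero_le ht α q
      | succ n ih =>
        intro α q
        have := integral_expKant_succ_of_ge ht (Nat.zero_le n) (ih (Nat.zero_le n)) α q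
        rwa [if_neg (h n)] at this
    intro α q
    rw [hones, pow_zero, pow_one]
    linarith [key α q]

theorem measurable_kant {ρ : ConfigSpace → ConfigSpace → ℝ} (hρ : ∀ q, Measurable fun p => ρ p q)
    (n : ℕ) : ∀ q, Measurable fun p => kant ρ n p q := by
  induction n with
  | zero => exact hρ
  | succ n ih =>
    intro q
    exact Measurable.min (((ih q).add ((ih (diag (gen n) q)).comp (measurable_diag _))).div_const 2)
      (((ih (diag (gen n) q)).add ((ih q).comp (measurable_diag _))).div_const 2)

theorem measurable_cutMetric (N : ℕ) (q : ConfigSpace) : Measurable fun p => cutMetric N p q := by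
  classical
  refine Measurable.ite ?_ measurable_const measurable_const
  have h1 : MeasurableSet {p : ConfigSpace | p.1 0 = q.1 0} :=
    measurableSet_eq_fun ((measurable_pi_apply 0).comp measurable_fst) measurable_const
  have h2 : MeasurableSet {p : ConfigSpace | ∀ i < N, p.2 i = q.2 i} := by
    simp only [Set.ofPred_forall]
    exact MeasurableSet.iInter fun i => MeasurableSet.iInter fun _ =>
      measurableSet_eq_fun ((measurable_pi_apply i).comp measurable_snd) measurable_const
  exact h1.inter h2

/-- For a suitable semimetric, balls of a fixed radius have doubly exponentially small measures. -/
theorem exists_measure_ball_le (σ : ℕ → Fin 2) :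
    ∃ N, ∃ ε₀ : ℝ, 0 < ε₀ ∧ ∀ n ≥ N, ∀ q,
      omegaSigma σ {p | kant (cutMetric N) n p q ≤ ε₀} ≤
        ENNReal.ofReal ((19 / 20 : ℝ) ^ 2 ^ ones σ n) := by
  obtain ⟨N, hN⟩ := exists_integral_expKant_le σ
  have hlog5 : 0 < Real.log 5 := Real.log_pos (by norm_num)
  have hlog : 0 < Real.log (19 / 18) := Real.log_pos (by norm_num)
  -- The radius is chosen so that the weight is at least `(18 / 19) ^ 2 ^ ones σ n` on the ball.
  -- Since `9 / 10 = 19 / 20 * (18 / 19)`, Markov's inequality for each fixed `α` leaves `19 / 20`.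
  refine ⟨N, Real.log (19 / 18) / Real.log 5, by positivity, fun n hn q => ?_⟩
  have hms : MeasurableSet {p | kant (cutMetric N) n p q ≤ Real.log (19 / 18) / Real.log 5} :=
    measurableSet_le (measurable_kant (measurable_cutMetric N) n q) measurable_const
  rw [omegaSigma, Measure.prod_apply_symm hms]
  have hα : ∀ α : ℕ → Bit, mSigma σ ((fun w => (w, α)) ⁻¹'
      {p | kant (cutMetric N) n p q ≤ Real.log (19 / 18) / Real.log 5}) ≤
      ENNReal.ofReal ((19 / 20 : ℝ) ^ 2 ^ ones σ n) := by
    intro α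
    have hmarkov := mul_meas_ge_le_integral_of_nonneg (μ := mSigma σ)
      (Eventually.of_forall fun w => (expKant_pos (σ := σ) (N := N) (n := n) (t := Real.log 5) α q w).le)
      (integrable_expKant hlog5.le α q) ((18 / 19 : ℝ) ^ 2 ^ ones σ n)
    have hsub : ((fun w => (w, α)) ⁻¹'
        {p | kant (cutMetric N) n p q ≤ Real.log (19 / 18) / Real.log 5}) ⊆
        {w | (18 / 19 : ℝ) ^ 2 ^ ones σ n ≤ expKant σ N (Real.log 5) n α q w} := by
      intro w (hw : kant (cutMetric N) n (w, α) q ≤ _)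
      change _ ≤ Real.exp _
      have h18 : (18 / 19 : ℝ) = Real.exp (-Real.log (19 / 18)) := by
        rw [Real.exp_neg, Real.exp_log (by norm_num)]
        norm_num
      rw [h18, ← Real.exp_nat_mul, Real.exp_le_exp]
      rw [le_div_iff₀ hlog5] at hw
      push_cast
      have h2 : (0 : ℝ) < 2 ^ ones σ n := by positivity
      nlinarith [mul_le_mul_of_nonneg_left hw h2.le]
    refine (measure_mono hsub).trans ?_
    refine (ENNReal.le_ofReal_iff_toReal_le (measure_ne_top _ _) (by positivity)).mpr ?_
    have h3 := hmarkov.trans (hN n hn α q)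
    have h4 : (19 / 20 : ℝ) ^ 2 ^ ones σ n * (18 / 19) ^ 2 ^ ones σ n =
        (9 / 10) ^ 2 ^ ones σ n := by
      rw [← mul_pow]
      norm_num
    rw [← h4, mul_comm] at h3
    exact le_of_mul_le_mul_right h3 (by positivity)
  calc _ ≤ ∫⁻ _ : ℕ → Bit, ENNReal.ofReal ((19 / 20 : ℝ) ^ 2 ^ ones σ n) ∂lebesgue ℕ :=
        lintegral_mono hα
    _ = _ := by simp

/-! The upper bound -/

/-- Two points have equal configurations on `DSub N` and equal first `N` indices. -/
def AgreeTo (N : ℕ) (p q : ConfigSpace) : Prop :=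
  (∀ h ∈ DSub N, p.1 h = q.1 h) ∧ ∀ i < N, p.2 i = q.2 i

/-- There is a separating sequence of functions that is uniformly continuous with respect to the
agreement on large blocks. -/
theorem exists_coordinates : ∃ G : ConfigSpace → ℕ → ℝ, Measurable G ∧ Function.Injective G ∧
    ∀ V ∈ 𝓤 (ℕ → ℝ), ∃ N, ∀ p q, AgreeTo N p q → (G p, G q) ∈ V := by
  obtain ⟨c, hc⟩ := exists_surjective_nat (DGroup ⊕ ℕ)
  let b : DGroup ⊕ ℕ → ConfigSpace → Bit := fun j p => Sum.elim p.1 p.2 j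
  have hb : ∀ j, Measurable (b j) := by
    rintro (g | i)
    · exact (measurable_pi_apply g).comp measurable_fst
    · exact (measurable_pi_apply i).comp measurable_snd
  let r : Bit → ℝ := fun x => if x = 0 then 0 else 1
  have hr : Function.Injective r := by
    intro x y h
    simp only [r] at h
    rcases bit_cases x with rfl | rfl <;> rcases bit_cases y with rfl | rfl <;> simp_all
  refine ⟨fun p i => r (b (c i) p), measurable_pi_lambda _ fun i =>
    (measurable_of_finite r).comp (hb _), fun p q h => ?_, fun V hV => ?_⟩
  · have hj : ∀ j, b j p = b j q := fun j => by
      obtain ⟨i, rfl⟩ := hc j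
      exact hr (congrFun h i)
    exact Prod.ext (funext fun g => hj (Sum.inl g)) (funext fun i => hj (Sum.inr i))
  · by_contra hcon
    push Not at hcon
    choose p q hpq hV' using hcon
    have ht : Tendsto (fun k => ((fun i => r (b (c i) (p k)) : ℕ → ℝ), fun i => r (b (c i) (q k))))
        atTop (𝓤 (ℕ → ℝ)) := by
      rw [Pi.uniformity, tendsto_iInf]
      intro i
      rw [tendsto_comap_iff]
      have hev : ∀ᶠ k in atTop, b (c i) (p k) = b (c i) (q k) := by
        rcases c i with g | j
        · filter_upwards [eventually_ge_atTop (level g)] with k hk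
          exact (hpq k).1 g (mem_DSub.mpr fun i hi => level_spec g i (hk.trans hi))
        · filter_upwards [eventually_gt_atTop j] with k hk
          exact (hpq k).2 j hk
      intro U hU
      rw [mem_map]
      filter_upwards [hev] with k hk
      simp only [Set.mem_preimage, Function.comp_apply, hk]
      exact refl_mem_uniformity hU
    obtain ⟨k, hk⟩ := (ht.eventually hV).exists
    exact hV' k hk

/-! ### Invariant configurations and their blocks -/

/-- The configuration is invariant under the shifts by the elements of `DSigma σ`. -/
def IsInvariant (σ : ℕ → Fin 2) (w : DGroup → Bit) : Prop := ∀ g ∈ DSigma σ, ∀ h, w (h + g) = w h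

theorem IsInvariant.shift {σ : ℕ → Fin 2} {w : DGroup → Bit} (hw : IsInvariant σ w) (k : DGroup) :
    IsInvariant σ fun h => w (h + k) := fun g hg h => by
  simp only [add_right_comm h g k]
  exact hw g hg (h + k)

theorem measurableSet_isInvariant (σ : ℕ → Fin 2) : MeasurableSet {w | IsInvariant σ w} := by
  simp only [IsInvariant, Set.ofPred_forall]
  refine MeasurableSet.iInter fun g => MeasurableSet.iInter fun _ => MeasurableSet.iInter fun h => ?_
  exact measurableSet_eq_fun (measurable_pi_apply _) (measurable_pi_apply _)

/-- The restrictions of the invariant configurations to `DSub n` can be numbered by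
`2 ^ 2 ^ ones σ n` labels. -/
theorem exists_blockIndex (σ : ℕ → Fin 2) (n : ℕ) :
    ∃ f : Vertex n → Fin (2 ^ 2 ^ ones σ n), ∀ w w', IsInvariant σ w → IsInvariant σ w' →
      f (unlabel n w) = f (unlabel n w') → unlabel n w = unlabel n w' := by
  induction n with
  | zero => exact ⟨fun v => (v.val : Fin 2), fun w w' _ _ h => h⟩
  | succ n ih =>
    obtain ⟨f, hf⟩ := ih
    -- The two halves of a block are labelled separately if `σ n = 1`, which squares the number of
    -- labels; they coincide if `σ n = 0`.
    by_cases hσ : σ n = 1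
    · have e : Fin (2 ^ 2 ^ ones σ n) × Fin (2 ^ 2 ^ ones σ n) ≃ Fin (2 ^ 2 ^ ones σ (n + 1)) :=
        Fintype.equivOfCardEq (by
          simp only [Fintype.card_prod, Fintype.card_fin, ones_succ_of_one hσ, pow_succ 2, pow_mul]
          ring)
      refine ⟨fun v => e (f v.fst, f v.snd), fun w w' hw hw' h => ?_⟩
      have h' := Prod.ext_iff.mp (e.injective h)
      exact Prod.ext (hf w w' hw hw' h'.1) (hf _ _ (hw.shift (gen n)) (hw'.shift (gen n)) h'.2)
    · have hσ0 : σ n = 0 := by omega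
      have hgen : gen n ∈ DSigma σ := AddSubgroup.subset_closure ⟨n, hσ0, rfl⟩
      rw [ones_succ_of_zero hσ0]
      refine ⟨fun v => f v.fst, fun w w' hw hw' h => ?_⟩
      have h1 : ∀ w, IsInvariant σ w → unlabel n (fun h => w (h + gen n)) = unlabel n w :=
        fun w hw => congrArg (unlabel n) (funext fun h => hw _ hgen h)
      have h2 := hf w w' hw hw' h
      exact Prod.ext h2 ((h1 w hw).trans (h2.trans (h1 w' hw').symm))

/-- Normalization makes the first `n` indices zero on both sides, so points with the same
translation number agree in them, and equality of the blocks survives translation inside `DSub n`.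
-/
theorem agreeTo_diag_normalize {n : ℕ} {p q : ConfigSpace}
    (h : unlabel n (normalize n p).1 = unlabel n (normalize n q).1) {g : DGroup} (hg : g ∈ DSub n) :
    AgreeTo n (diag g (normalize n p)) (diag g (normalize n q)) := by
  constructor
  · intro k hk
    have hkg := mem_DSub.mp (add_mem hk hg)
    change (normalize n p).1 (k + g) = (normalize n q).1 (k + g)
    rw [← label_unlabel n (normalize n p).1 _ hkg, ← label_unlabel n (normalize n q).1 _ hkg, h]
  · intro i hi
    have h0 : ∀ p, (normalize n p).2 i = 0 := fun p => by
      change p.2 i + partialSum p.2 n i = 0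
      rw [partialSum_apply, if_pos hi, bit_add_self]
    change (normalize n p).2 i + g i = (normalize n q).2 i + g i
    rw [h0, h0]

theorem AgreeTo.mono {m n : ℕ} (hmn : m ≤ n) {p q : ConfigSpace} (h : AgreeTo n p q) :
    AgreeTo m p q :=
  ⟨fun k hk => h.1 k (DSub_mono hmn hk), fun i hi => h.2 i (hi.trans_le hmn)⟩

theorem mk_normalize (n : ℕ) (p : ConfigSpace) :
    Quotient.mk (zeta n) (normalize n p) = Quotient.mk (zeta n) p :=
  Quotient.sound ((zeta n).symm (zeta_diag_self.mpr (partialSum_mem_DSub _ _)))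

theorem orbitAvg_normalize (n : ℕ) (f : ConfigSpace → ℝ) (p : ConfigSpace) :
    orbitAvg n f (normalize n p) = orbitAvg n f p := orbitAvg_diag (partialSum_mem_DSub _ _) f p

theorem exists_hasEpsPartition {σ : ℕ → Fin 2} {ρ : ConfigSpace → ConfigSpace → ℝ}
    (hρ : IsSummableAdmissibleMetric (omegaSigma σ) ρ) {ε : ℝ} (hε : 0 < ε) :
    ∃ N, ∀ n ≥ N, HasEpsPartition ((omegaSigma σ).map (Quotient.mk (zeta n)))
      (kantorovichIter zeta ρ n) ε (2 ^ 2 ^ ones σ n) := by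
  classical
  obtain ⟨G, hG, hGinj, hGV⟩ := exists_coordinates
  obtain ⟨V, hV, g, hgm, hg0, hgi, hgε, Z, hZ, hZ0, hZV⟩ :=
    -- The bound `ε ^ 2 / 8` on the integral gives, at level `ε / 4`, exceptional measure below `ε /
    -- 2`. The bound `ε / 4` is the first of three equal contributions to the diameter `3 * ε / 4`.
    hρ.exists_majorant hG hGinj (show 0 < min (ε / 4) (ε ^ 2 / 8) by positivity)
  obtain ⟨N, hN⟩ := hGV V hV
  refine ⟨N, fun n hn => ?_⟩
  obtain ⟨f, hf⟩ := exists_blockIndex σ n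
  -- The exceptional set is a union of orbits, so the labelling `J` descends to the quotient. All
  -- translates of `Z` are included, a countable union of null sets.
  set E : Set ConfigSpace := {p | ε / 4 ≤ orbitAvg n g p} ∪
    ((⋃ h, diag h ⁻¹' Z) ∪ {p | ¬ IsInvariant σ p.1}) with hE
  have hEm : MeasurableSet E := (measurableSet_le measurable_const (measurable_orbitAvg hgm)).union
    ((MeasurableSet.iUnion fun h => measurable_diag h hZ).union
      (measurable_fst (measurableSet_isInvariant σ)).compl)
  have hEinv : ∀ p, ∀ k ∈ DSub n, diag k p ∈ E → p ∈ E := by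
    rintro p k hk (h | h | h)
    · left
      rwa [Set.mem_ofPred_eq, orbitAvg_diag hk] at h
    · obtain ⟨l, hl⟩ := Set.mem_iUnion.mp h
      rw [Set.mem_preimage, diag_diag] at hl
      exact Or.inr (Or.inl (Set.mem_iUnion.mpr ⟨_, hl⟩))
    · exact Or.inr (Or.inr fun hp => h (hp.shift k))
  have hEiff : ∀ p, ∀ k ∈ DSub n, p ∈ E ↔ diag k p ∈ E := fun p k hk =>
    ⟨fun h => hEinv _ k hk (by rwa [diag_diag, d_add_self, diag_zero]), hEinv p k hk⟩
  have hEμ : omegaSigma σ E < ENNReal.ofReal ε := by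
    have h1 : omegaSigma σ ((⋃ h, diag h ⁻¹' Z) ∪ {p | ¬ IsInvariant σ p.1}) = 0 := by
      rw [measure_union_null_iff, measure_iUnion_null_iff]
      refine ⟨fun h => (measurePreserving_diag σ h).quasiMeasurePreserving.preimage_null hZ0, ?_⟩
      exact Measure.quasiMeasurePreserving_fst.preimage_null (ae_mSigma_invariant σ)
    refine (measure_union_le _ _).trans_lt ?_
    rw [h1, add_zero]
    refine (measure_le_orbitAvg n hgm hg0 hgi (by positivity)).trans_lt ?_
    rw [ENNReal.ofReal_lt_ofReal_iff hε, div_lt_iff₀ (by positivity)]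
    have := hgε.trans_le (min_le_right _ _)
    nlinarith
  let J : ConfigSpace → Fin (2 ^ 2 ^ ones σ n + 1) := fun p =>
    if p ∈ E then 0 else (f (unlabel n (normalize n p).1)).succ
  have hJm : Measurable J := Measurable.ite hEm measurable_const
    ((measurable_of_finite fun v => (f v).succ).comp
      ((measurable_unlabel n).comp (measurable_fst.comp (measurable_normalize n))))
  have hJinv : ∀ p q, zeta n p q → J p = J q := by
    rintro p q ⟨k, hk, rfl⟩
    simp only [J, normalize_diag hk, ← hEiff p k hk]
  let J' : Quotient (zeta n) → Fin (2 ^ 2 ^ ones σ n + 1) := Quotient.lift J hJinv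
  have hJ'm : Measurable J' := measurable_from_quotient.mpr hJm
  refine ⟨fun j => J' ⁻¹' {j}, fun j => hJ'm (measurableSet_singleton j), fun i j hij =>
    Disjoint.preimage _ (by simpa using hij), ?_, ?_, fun j => ⟨3 * ε / 4, by linarith, ?_⟩⟩
  · ext c
    simp
  · rw [Measure.map_apply measurable_quotient_mk'' (hJ'm (measurableSet_singleton 0))]
    refine (measure_mono fun p hp => ?_).trans_lt hEμ
    by_contra hpE
    have hp' : J p = 0 := hp
    simp only [J, if_neg hpE] at hp'
    exact Fin.succ_ne_zero _ hp'
  · intro c hc c' hc'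
    induction c using Quotient.inductionOn with
    | h p =>
    induction c' using Quotient.inductionOn with
    | h q =>
    have hJ : ∀ p, J p = j.succ → p ∉ E ∧ f (unlabel n (normalize n p).1) = j := fun p hp => by
      by_cases hpE : p ∈ E
      · simp only [J, if_pos hpE] at hp
        exact absurd hp.symm (Fin.succ_ne_zero _)
      · simp only [J, if_neg hpE] at hp
        exact ⟨hpE, Fin.succ_injective _ hp⟩
    obtain ⟨hpE, hpj⟩ := hJ p hc
    obtain ⟨hqE, hqj⟩ := hJ q hc'
    simp only [hE, Set.mem_union, Set.mem_ofPred_eq, not_or, not_le, not_not, Set.mem_iUnion,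
      Set.mem_preimage, not_exists] at hpE hqE
    have hkey := hf _ _ (hpE.2.2.shift (partialSum p.2 n)) (hqE.2.2.shift (partialSum q.2 n))
      (hpj.trans hqj.symm)
    rw [← mk_normalize n p, ← mk_normalize n q]
    refine (kantorovichIter_le hρ.semimetric.nonneg n _ _).trans ?_
    have hpt : ∀ k ∈ dFin n, ρ (diag k (normalize n p)) (diag k (normalize n q)) ≤
        ε / 4 + g (diag k (normalize n p)) + g (diag k (normalize n q)) := by
      intro k hk
      have hZp : diag k (normalize n p) ∉ Z := by rw [normalize, diag_diag]; exact hpE.2.1 _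
      have hZq : diag k (normalize n q) ∉ Z := by rw [normalize, diag_diag]; exact hqE.2.1 _
      have := hZV _ hZp _ hZq
        (hN _ _ ((agreeTo_diag_normalize hkey (mem_dFin.mp hk)).mono hn))
      linarith [min_le_left (ε / 4) (ε ^ 2 / 8)]
    calc (1 / 2 ^ n : ℝ) * ∑ k ∈ dFin n, ρ (diag k (normalize n p)) (diag k (normalize n q))
        ≤ (1 / 2 ^ n : ℝ) * ∑ k ∈ dFin n,
          (ε / 4 + g (diag k (normalize n p)) + g (diag k (normalize n q))) :=
          mul_le_mul_of_nonneg_left (Finset.sum_le_sum hpt) (by positivity)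
      _ = ε / 4 + orbitAvg n g (normalize n p) + orbitAvg n g (normalize n q) := by
          rw [Finset.sum_add_distrib, Finset.sum_add_distrib, orbitAvg, orbitAvg, mul_add, mul_add,
            Finset.sum_const, card_dFin, nsmul_eq_mul]
          push_cast
          field_simp
      _ ≤ 3 * ε / 4 := by
          rw [orbitAvg_normalize, orbitAvg_normalize]
          linarith [hpE.1, hqE.1]

/-! The lower bound -/

/-- Outside the orbits that spend too much time in `B`, a set of small diameter for `ρ` lies in a
ball of the iterated `cutMetric N`. Such balls are tiny, so many are needed to cover the space. -/
theorem exists_le_of_hasEpsPartition {σ : ℕ → Fin 2} {ρ : ConfigSpace → ConfigSpace → ℝ}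
    (hρ : IsSummableAdmissibleMetric (omegaSigma σ) ρ) :
    ∃ N, ∃ ε₁ : ℝ, 0 < ε₁ ∧ ∀ n ≥ N, ∀ ε : ℝ, ε < ε₁ → ∀ k : ℕ,
      HasEpsPartition ((omegaSigma σ).map (Quotient.mk (zeta n))) (kantorovichIter zeta ρ n) ε k →
      (49 / 50 : ℝ) ≤ k * (19 / 20 : ℝ) ^ 2 ^ ones σ n := by
  obtain ⟨N, ε₀, hε₀, hball⟩ := exists_measure_ball_le σ
  obtain ⟨enc, henc⟩ := exists_injective_nat (Bit × (Fin N → Bit))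
  let l : ConfigSpace → ℕ := fun p => enc (p.1 0, fun i => p.2 i)
  have hl : Measurable l := (measurable_of_countable enc).comp
    (((measurable_pi_apply 0).comp measurable_fst).prodMk
      (measurable_pi_lambda _ fun i => (measurable_pi_apply _).comp measurable_snd))
  have hlagree : ∀ p q, l p = l q → AgreeAt N p q := fun p q h => by
    have h' := Prod.ext_iff.mp (henc h)
    exact ⟨h'.1, fun i hi => congrFun h'.2 ⟨i, hi⟩⟩
  obtain ⟨B, hB, hBμ, δ, hδ, hBδ⟩ := hρ.exists_label hl
    (ENNReal.ofReal_pos.mpr (show 0 < ε₀ / 4 * (1 / 100) by positivity)).ne'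
  set b : ConfigSpace → ℝ := B.indicator 1 with hb
  have hbm : Measurable b := measurable_one.indicator hB
  have hb0 : ∀ p, 0 ≤ b p := Set.indicator_nonneg fun _ _ => zero_le_one
  have hbi : Integrable b (omegaSigma σ) :=
    (integrable_const (1 : ℝ)).indicator hB
  have hbint : ∫ p, b p ∂omegaSigma σ ≤ ε₀ / 4 * (1 / 100) := by
    rw [hb, integral_indicator_one hB]
    exact ENNReal.toReal_le_of_le_ofReal (by positivity) hBμ.le
  -- Off `B`, points closer than `δ` have equal labels and `cutMetric` vanishes; in all other cases
  -- one of the terms on the right is at least 1.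
  have hcomp : ∀ p q, cutMetric N p q ≤ δ⁻¹ * ρ p q + b p + b q := by
    intro p q
    have hρ0 : 0 ≤ δ⁻¹ * ρ p q := mul_nonneg (by positivity) (hρ.semimetric.nonneg p q)
    by_cases hp : p ∈ B
    · have : b p = 1 := Set.indicator_of_mem hp _
      linarith [cutMetric_le_one N p q, hb0 q]
    by_cases hq : q ∈ B
    · have : b q = 1 := Set.indicator_of_mem hq _
      linarith [cutMetric_le_one N p q, hb0 p]
    by_cases hd : ρ p q < δ
    · have : cutMetric N p q = 0 := if_pos (hlagree p q (hBδ p hp q hq hd))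
      linarith [hb0 p, hb0 q]
    · have : 1 ≤ δ⁻¹ * ρ p q := by
        rw [inv_mul_eq_div, le_div_iff₀ hδ, one_mul]
        exact not_lt.mp hd
      linarith [cutMetric_le_one N p q, hb0 p, hb0 q]
  -- A diameter below `δ * ε₀ / 2` contributes `ε₀ / 2` to the radius, and the two orbit averages
  -- contribute less than `ε₀ / 4` each.
  refine ⟨N, min (1 / 100) (δ * ε₀ / 2), by positivity, fun n hn ε hε k hk => ?_⟩
  obtain ⟨P, hP, -, hPu, hP0, hPδ⟩ := hk
  have hmk : Measurable (Quotient.mk (zeta n)) := measurable_quotient_mk''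
  set E : Set ConfigSpace := {p | ε₀ / 4 ≤ orbitAvg n b p} with hE
  have hEμ : omegaSigma σ E ≤ ENNReal.ofReal (1 / 100) := by
    refine (measure_le_orbitAvg n hbm hb0 hbi (by positivity)).trans
      (ENNReal.ofReal_le_ofReal ?_)
    rw [div_le_iff₀ (by positivity)]
    linarith
  have hj : ∀ j : Fin k, omegaSigma σ (Quotient.mk (zeta n) ⁻¹' P j.succ \ E) ≤
      ENNReal.ofReal ((19 / 20 : ℝ) ^ 2 ^ ones σ n) := by
    intro j
    rcases (Quotient.mk (zeta n) ⁻¹' P j.succ \ E).eq_empty_or_nonempty with h | ⟨q, hqP, hqE⟩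
    · rw [h, measure_empty]
      exact zero_le
    · refine (measure_mono fun p hp => ?_).trans (hball n hn q)
      obtain ⟨d, hd, hPd⟩ := hPδ j
      have h1 := hPd _ hp.1 _ hqP
      have h2 := (kant_le_kantorovichIter (cutMetric N) n p q).trans
        (kantorovichIter_comparison (cutMetric_nonneg N) (inv_pos.mpr hδ) hcomp n p q)
      have h3 : orbitAvg n b p < ε₀ / 4 := not_le.mp hp.2
      have h4 : orbitAvg n b q < ε₀ / 4 := not_le.mp hqE
      have h5 : δ⁻¹ * kantorovichIter zeta ρ n (Quotient.mk _ p) (Quotient.mk _ q) ≤ ε₀ / 2 := by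
        rw [inv_mul_eq_div, div_le_iff₀ hδ]
        linarith [min_le_right (1 / 100) (δ * ε₀ / 2)]
      change kant (cutMetric N) n p q ≤ ε₀
      linarith
  have hcover : (Set.univ : Set ConfigSpace) ⊆ (Quotient.mk (zeta n) ⁻¹' P 0 ∪ E) ∪
      ⋃ j : Fin k, (Quotient.mk (zeta n) ⁻¹' P j.succ \ E) := by
    intro p _
    by_cases hpE : p ∈ E
    · exact Or.inl (Or.inr hpE)
    obtain ⟨j, hj⟩ := Set.mem_iUnion.mp (hPu ▸ Set.mem_univ (Quotient.mk (zeta n) p))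
    rcases Fin.eq_zero_or_eq_succ j with rfl | ⟨j, rfl⟩
    · exact Or.inl (Or.inl hj)
    · exact Or.inr (Set.mem_iUnion.mpr ⟨j, hj, hpE⟩)
  rw [Measure.map_apply hmk (hP 0)] at hP0
  -- The part `P 0` and the set `E` take at most `1 / 100` each, which leaves `49 / 50` for the
  -- balls.
  have htot : 1 ≤ ENNReal.ofReal (1 / 100 + 1 / 100 + k * (19 / 20 : ℝ) ^ 2 ^ ones σ n) := by
    calc (1 : ℝ≥0∞) = omegaSigma σ Set.univ := measure_univ.symm
      _ ≤ omegaSigma σ (Quotient.mk (zeta n) ⁻¹' P 0) + omegaSigma σ E +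
          ∑ j : Fin k, omegaSigma σ (Quotient.mk (zeta n) ⁻¹' P j.succ \ E) :=
          (measure_mono hcover).trans ((measure_union_le _ _).trans
            (add_le_add (measure_union_le _ _) (measure_iUnion_fintype_le _ _)))
      _ ≤ ENNReal.ofReal (1 / 100) + ENNReal.ofReal (1 / 100) +
          ∑ _j : Fin k, ENNReal.ofReal ((19 / 20 : ℝ) ^ 2 ^ ones σ n) := by
          refine add_le_add (add_le_add (hP0.le.trans (ENNReal.ofReal_le_ofReal ?_)) hEμ)
            (Finset.sum_le_sum fun j _ => hj j)
          exact hε.le.trans (min_le_left _ _)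
      _ = _ := by
          rw [Finset.sum_const, Finset.card_univ, Fintype.card_fin, nsmul_eq_mul,
            ENNReal.ofReal_add (by positivity) (by positivity),
            ENNReal.ofReal_add (by positivity) (by positivity),
            ENNReal.ofReal_mul (by positivity), ENNReal.ofReal_natCast]
  rw [ENNReal.one_le_ofReal] at htot
  linarith

/-! The scaling sequence -/

theorem isScalingFor_zeta {σ : ℕ → Fin 2} {ρ : ConfigSpace → ConfigSpace → ℝ}
    (hρ : IsSummableAdmissibleMetric (omegaSigma σ) ρ) :
    IsScalingFor (omegaSigma σ) zeta ρ fun n => (2 : ℝ) ^ ones σ n := by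
  obtain ⟨N, ε₁, hε₁, hlow⟩ := exists_le_of_hasEpsPartition hρ
  refine ⟨ε₁, hε₁, fun ε hε hεε => ⟨?_, ?_⟩⟩
  -- Since `98 / 95 * (19 / 20) = 49 / 50`, the number of parts is at least `(98 / 95) ^ 2 ^ ones σ
  -- n`, even when the exponent stays bounded.
  · set c : ℝ := Real.logb 2 (98 / 95) with hc
    have hc0 : 0 < c := Real.logb_pos (by norm_num) (by norm_num)
    refine (ENNReal.ofReal_pos.mpr hc0).trans_le
      (le_liminf_of_le (by isBoundedDefault) ?_)
    filter_upwards [eventually_ge_atTop N] with n hn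
    have h2 : (0 : ℝ) < 2 ^ ones σ n := by positivity
    rw [ENNReal.le_div_iff_mul_le (Or.inl (ENNReal.ofReal_pos.mpr h2).ne')
      (Or.inl ENNReal.ofReal_ne_top), ← ENNReal.ofReal_mul hc0.le]
    refine le_iInf₂ fun k hk => ENNReal.ofReal_le_ofReal ?_
    have hkey := hlow n hn ε hεε k hk.2
    rw [Real.le_logb_iff_rpow_le (by norm_num) (by exact_mod_cast hk.1), Real.rpow_mul (by norm_num),
      hc, Real.rpow_logb (by norm_num) (by norm_num) (by norm_num),
      show (2 : ℝ) ^ ones σ n = ((2 ^ ones σ n : ℕ) : ℝ) by push_cast; rfl, Real.rpow_natCast]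
    have hm : 1 ≤ 2 ^ ones σ n := Nat.one_le_two_pow
    have h3 : (98 / 95 : ℝ) ^ 2 ^ ones σ n * (19 / 20) ^ 2 ^ ones σ n = (49 / 50) ^ 2 ^ ones σ n := by
      rw [← mul_pow]
      norm_num
    have h4 : (49 / 50 : ℝ) ^ 2 ^ ones σ n ≤ 49 / 50 :=
      (pow_le_pow_of_le_one (by norm_num) (by norm_num) hm).trans_eq (pow_one _)
    exact le_of_mul_le_mul_right (h3.trans_le (h4.trans hkey)) (by positivity)
  -- The logarithm of `2 ^ 2 ^ ones σ n` is exactly the proposed scale, so the ratio is eventually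
  -- at most 1, for every positive `ε`.
  · obtain ⟨M, hM⟩ := exists_hasEpsPartition hρ hε
    refine (limsup_le_of_le (a := 1) (by isBoundedDefault) ?_).trans_lt ENNReal.one_lt_top
    filter_upwards [eventually_ge_atTop M] with n hn
    refine ENNReal.div_le_of_le_mul ?_
    rw [one_mul]
    refine (iInf₂_le (2 ^ 2 ^ ones σ n) ⟨by positivity, hM n hn⟩).trans
      (ENNReal.ofReal_le_ofReal (le_of_eq ?_))
    push_cast
    rw [Real.logb_pow, Real.logb_self_eq_one (by norm_num)]
    push_cast
    ring

theorem isScalingSequence_zeta (σ : ℕ → Fin 2) :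
    IsScalingSequence (omegaSigma σ) zeta fun n => (2 : ℝ) ^ ones σ n where
  dyadic := isDyadicFiltration_zeta σ
  pos _ _ := by positivity
  some_metric := by
    obtain ⟨ρ, hρ⟩ := exists_isSummableAdmissibleMetric (omegaSigma σ)
    exact ⟨ρ, hρ, isScalingFor_zeta hρ⟩
  every_metric _ hρ := isScalingFor_zeta hρ

end ScaledEntropy

end

theorem theorem9 (σ : ℕ → Fin 2) :
    ScaledEntropy.IsScalingSequence (ScaledEntropy.omegaSigma σ) ScaledEntropy.zeta
        (fun n => (2 : ℝ) ^ (∑ i ∈ Finset.range n, (σ i : ℕ))) ∧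
      ScaledEntropy.IsScalingSequence (ScaledEntropy.muSigma σ) ScaledEntropy.xi
        (fun n => (2 : ℝ) ^ (∑ i ∈ Finset.range n, (σ i : ℕ))) ∧
      ScaledEntropy.IsFiltrationIso (ScaledEntropy.muSigma σ) ScaledEntropy.xi
        (ScaledEntropy.omegaSigma σ) ScaledEntropy.zeta ScaledEntropy.Psi :=
  ⟨ScaledEntropy.isScalingSequence_zeta σ,
    (ScaledEntropy.isFiltrationIso_Psi σ).isScalingSequence
      (ScaledEntropy.isScalingSequence_zeta σ),
    ScaledEntropy.isFiltrationIso_Psi σ⟩
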